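/- All graphs are finite and simple (no loops). For a fixed graph $H$, an instance of \textsc{Max Partial $H$-Coloring} is a pair $(G,\mathrm{rev})$ of a graph $G$ and a function $\mathrm{rev}\colon V(G)\times V(H)\to\mathbb{R}$. A solution is a partial $H$-coloring of $G$, that is, a partial function $\phi\colon V(G)\rightharpoonup V(H)$ such that $\phi(u)\phi(v)\in E(H)$ for every edge $uv\in E(G)$ with $u,v\in\mathrm{dom}\,\phi$. The task is to output a solution $\phi$ that maximizes $\sum_{u\in\mathrm{dom}\,\phi}\mathrm{rev}(u,\phi(u))$. For a set $\mathcal{F}$ of graphs, $G$ is $\mathcal{F}$-free if no induced subgraph of $G$ is isomorphic to a member of $\mathcal{F}$. A module of $G$ is a set $B\subseteq V(G)$ such that every vertex outside $B$ is adjacent to all or to none of the vertices of $B$; $G$ is prime if it has no module $B$ with $2\le |B|<|V(G)|$. The problem can be solved in polynomial time in a class of graphs if there is a single algorithm that outputs an optimum solution for every instance $(G,\mathrm{rev})$ with $G$ in the class, in a number of steps bounded by a polynomial in $|V(G)|$. Here algorithms work on pointer structures that can hold real numbers, and exact arithmetic operations ($+,-,\cdot,/$) and comparisons of two reals take one step each,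 as do the elementary pointer operations (the real-RAM convention); the algorithm and the polynomial may depend on $H$ and on the class. \textbf{Theorem.} Let $\mathcal{F}$ be a (possibly infinite) set of graphs such that for every fixed graph $H$ without loops, \textsc{Max Partial $H$-Coloring} can be solved in polynomial time in prime $\mathcal{F}$-free graphs. Then for every fixed graph $H$ without loops, \textsc{Max Partial $H$-Coloring} can be solved in polynomial time in $\mathcal{F}$-free graphs. -/

import Mathlib

namespace MaxPartial

/-! ## Graphs -/

/-- A module (homogeneous set): every vertex outside `B` is complete or anti-complete to `B`. -/
def IsGraphModule {V : Type*} (G : SimpleGraph V) (B : Set V) : Prop :=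
  ∀ u, u ∉ B → (∀ b ∈ B, G.Adj u b) ∨ (∀ b ∈ B, ¬ G.Adj u b)

/-- A graph on `n` vertices is prime if it has no proper module,
i.e. no module `B` with `2 ≤ |B| < n`. -/
def IsPrimeGraph {n : ℕ} (G : SimpleGraph (Fin n)) : Prop :=
  ∀ B : Finset (Fin n), IsGraphModule G (B : Set (Fin n)) → ¬ (2 ≤ B.card ∧ B.card < n)

/-- `G` contains no member of `F` as an induced subgraph. A set of (finite) graphs is given by
representatives on the vertex sets `Fin m`. -/
def IsFamilyFree (F : Set (Σ m : ℕ, SimpleGraph (Fin m))) {V : Type*} (G : SimpleGraph V) : Prop :=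
  ∀ X ∈ F, ¬ X.2.IsIndContained G

/-! ## The optimization problem -/

/-- The partial function `φ` from `V` to `W` (with `φ u = none` for `u` outside the domain)
is a homomorphism from `G[dom φ]` to `H`. -/
def IsPartialColoring {V W : Type*} (G : SimpleGraph V) (H : SimpleGraph W)
    (φ : V → Option W) : Prop :=
  ∀ u v, G.Adj u v → ∀ a b, φ u = some a → φ v = some b → H.Adj a b

/-- The revenue of `φ`: the sum of `rev u (φ u)` over the domain of `φ`. -/
def revenue {V W : Type*} [Fintype V] (rev : V → W → ℝ) (φ : V → Option W) : ℝ :=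
  ∑ u, (φ u).elim 0 (rev u)

/-- `φ` is an optimum solution of the instance `(G, rev)` of Max Partial `H`-Coloring. -/
def IsOptimum {V W : Type*} [Fintype V] (G : SimpleGraph V) (H : SimpleGraph W)
    (rev : V → W → ℝ) (φ : V → Option W) : Prop :=
  IsPartialColoring G H φ ∧ ∀ ψ, IsPartialColoring G H ψ → revenue rev ψ ≤ revenue rev φ

/-! ## The model of computation

Programs manipulate pointer structures (binary trees) whose leaves are `nil` or hold a real number;
every elementary operation takes one step. The elementary operations are those of a pointer
machine (build a pair, follow a pointer, test the kind of a node), together with those of a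
real RAM: the exact operations `+`, `-`, `*`, `/` and the comparison `≤` of two reals. The only
real constants are `0` and `1`, and there is no rounding. -/

/-- The data of programs. -/
inductive Data : Type
  | nil : Data
  | real (r : ℝ) : Data
  | pair (a b : Data) : Data

/-- Truth values: `false` is `nil`, `true` is the pair of two `nil`s. -/
def Data.ofBool : Bool → Data
  | false => .nil
  | true => .pair .nil .nil

/-- A list as a linked list terminated by `nil`. -/
def Data.ofList : List Data → Data
  | [] => .nil
  | a :: l => .pair a (Data.ofList l)

/-- A natural number in unary, as the list of `m` copies of `nil`. -/
def Data.ofNat (m : ℕ) : Data := Data.ofList (List.replicate m .nil)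

/-- Elementary operations. -/
inductive Prim : Type
  | id | nil | zero | one | fst | snd | isPair | isReal | add | sub | mul | div | le

/-- The effect of an elementary operation. Binary operations on reals act on a pair of reals;
operations applied to data of the wrong kind return `nil`. -/
noncomputable def Prim.eval : Prim → Data → Data
  | .id, x => x
  | .nil, _ => .nil
  | .zero, _ => .real 0
  | .one, _ => .real 1
  | .fst, .pair a _ => a
  | .snd, .pair _ b => b
  | .isPair, .pair _ _ => Data.ofBool true
  | .isReal, .real _ => Data.ofBool true
  | .add, .pair (.real a) (.real b) => .real (a + b)
  | .sub, .pair (.real a) (.real b) => .real (a - b)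
  | .mul, .pair (.real a) (.real b) => .real (a * b)
  | .div, .pair (.real a) (.real b) => .real (a / b)
  | .le, .pair (.real a) (.real b) => open Classical in Data.ofBool (decide (a ≤ b))
  | _, _ => .nil

/-- Programs; a program transforms its input into its output.
* `prim o`: apply an elementary operation;
* `pair p q`: run `p` and `q` on the input and pair up the results;
* `seq p q`: run `p`, then run `q` on the result;
* `cond c p q`: run `c` on the input; if the result is not `nil`, run `p` on the input,
  otherwise run `q` on the input;
* `loop c p`: while the result of `c` on the current value is not `nil`, replace the current
  value by the result of `p` on it. -/
inductive Prog : Type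
  | prim (o : Prim) : Prog
  | pair (p q : Prog) : Prog
  | seq (p q : Prog) : Prog
  | cond (c p q : Prog) : Prog
  | loop (c p : Prog) : Prog

/-- `Run p x y t`: on input `x`, the program `p` halts with output `y` after exactly `t` steps. -/
inductive Run : Prog → Data → Data → ℕ → Prop
  | prim (o : Prim) (x : Data) : Run (.prim o) x (o.eval x) 1
  | pair {p q : Prog} {x a b : Data} {s t : ℕ} :
      Run p x a s → Run q x b t → Run (.pair p q) x (.pair a b) (s + t + 1)
  | seq {p q : Prog} {x y z : Data} {s t : ℕ} :
      Run p x y s → Run q y z t → Run (.seq p q) x z (s + t + 1)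
  | cond_true {c p q : Prog} {x b y : Data} {s t : ℕ} :
      Run c x b s → b ≠ .nil → Run p x y t → Run (.cond c p q) x y (s + t + 1)
  | cond_false {c p q : Prog} {x y : Data} {s t : ℕ} :
      Run c x .nil s → Run q x y t → Run (.cond c p q) x y (s + t + 1)
  | loop_stop {c p : Prog} {x : Data} {s : ℕ} :
      Run c x .nil s → Run (.loop c p) x x (s + 1)
  | loop_step {c p : Prog} {x b y z : Data} {s t u : ℕ} :
      Run c x b s → b ≠ .nil → Run p x y t → Run (.loop c p) y z u →
        Run (.loop c p) x z (s + t + u + 1)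

/-! ## Polynomial-time solvability -/

/-- The `n × m` matrix with entries `A i j` as the list of its rows. -/
def encodeMatrix {n m : ℕ} (A : Fin n → Fin m → Data) : Data :=
  Data.ofList (List.ofFn fun i => Data.ofList (List.ofFn fun j => A i j))

open Classical in
/-- An instance `(G, rev)` is encoded as the adjacency matrix of `G`, paired with the matrix of
revenues. -/
noncomputable def encodeInstance {n k : ℕ} (G : SimpleGraph (Fin n))
    (rev : Fin n → Fin k → ℝ) : Data :=
  .pair (encodeMatrix fun u v => Data.ofBool (decide (G.Adj u v)))
    (encodeMatrix fun u a => .real (rev u a))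

/-- "Not in the domain" is `nil`, and the color `a` is the singleton list of the numeral `a`. -/
def encodeColor {k : ℕ} : Option (Fin k) → Data
  | none => .nil
  | some a => .pair (Data.ofNat a) .nil

/-- A partial coloring is encoded as the list of its values. -/
def encodeColoring {n k : ℕ} (φ : Fin n → Option (Fin k)) : Data :=
  Data.ofList (List.ofFn fun u => encodeColor (φ u))

/-- For the fixed pattern graph `H`, Max Partial `H`-Coloring can be solved in polynomial time in
the graphs from the class `C`: some program outputs, for every instance `(G, rev)` with
`G` in `C`, an optimum solution, in a number of steps polynomial in the number of vertices
of `G`. -/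
def SolvableInPolyTime {k : ℕ} (H : SimpleGraph (Fin k))
    (C : ∀ n : ℕ, SimpleGraph (Fin n) → Prop) : Prop :=
  ∃ (p : Prog) (P : Polynomial ℕ), ∀ (n : ℕ) (G : SimpleGraph (Fin n)), C n G →
    ∀ rev : Fin n → Fin k → ℝ, ∃ (φ : Fin n → Option (Fin k)) (t : ℕ),
      Run p (encodeInstance G rev) (encodeColoring φ) t ∧ IsOptimum G H rev φ ∧ t ≤ P.eval n

end MaxPartial

namespace MaxPartial

/-! ## Typed data and polynomial-time computable families -/

/-! Fix `H` and let `setGraph H` be the graph whose vertices are the sets of colors, two distinct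
sets being adjacent when they are complete to each other in `H`. If `G` is partitioned into modules
`X j` with quotient `Q`, a partial `H`-coloring of `G` assigns to each `X j` the set of colors it
uses there, and adjacent modules receive complete sets. Nonempty complete sets are distinct because
`H` has no loops, so this is a partial `setGraph H`-coloring of `Q` once the modules with empty
color set are left uncolored. Conversely, any such coloring of `Q` can be filled in with
independently chosen colorings of the modules. Hence, for a color set `S`, the best coloring of the
union with colors in `S` comes from an optimum for `setGraph H` on `Q`, where giving color `T` to
`j` earns the best revenue of `X j` with colors in `T ∩ S` (`IsOptimumOn.merge`).

The hypothesis is applied to the single pattern `setGraph H`, on prime graphs only. Keep a list of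
representatives of modules partitioning `G`, with a table of optima for every representative and
every `S`. A smallest module with at least two elements in the graph of representatives induces a
prime graph, since a module of a module is a module (`subG_minModule_isPrime`), and an induced
subgraph of an `F`-free graph is `F`-free. Solve it once for each of the constantly many `S`, then
contract it to one representative (`StateOk.contract`). After `n` rounds one representative is left,
and its entry for the full color set is the answer.

Running times are handled by `PolyTime sz c e`: one program computes `e i` from the context `c i`
for all indices `i`. A binder enlarges the context and replaces the index type by a subtype that
records what is known about the new variable; polynomial bounds are always in the size `sz` of the
original instance. -/

/-- Types whose elements are represented by data. -/
class Enc (α : Type) where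
  /-- The representation. -/
  enc : α → Data

open Enc

instance : Enc Unit := ⟨fun _ => .nil⟩
instance : Enc Bool := ⟨Data.ofBool⟩
instance : Enc ℝ := ⟨.real⟩
instance : Enc ℕ := ⟨Data.ofNat⟩
instance {α β : Type} [Enc α] [Enc β] : Enc (α × β) := ⟨fun x => .pair (enc x.1) (enc x.2)⟩
instance {α : Type} [Enc α] : Enc (List α) := ⟨fun l => Data.ofList (l.map enc)⟩
instance {α : Type} [Enc α] : Enc (Option α) := ⟨fun x => x.elim .nil fun a => .pair (enc a) .nil⟩

theorem enc_nat (m : ℕ) : enc m = enc (List.replicate m ()) := by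
  change Data.ofList _ = Data.ofList _
  rw [List.map_replicate]; rfl

/-- `f` is bounded by a polynomial in `sz`. -/
def PolyBdd {ι : Type} (sz f : ι → ℕ) : Prop := ∃ P : Polynomial ℕ, ∀ i, f i ≤ P.eval (sz i)

/-- One program computes `e i` from `c i` for all `i`, in time polynomial in `sz i`. -/
def PolyTime {ι γ α : Type} [Enc γ] [Enc α] (sz : ι → ℕ) (c : ι → γ) (e : ι → α) : Prop :=
  ∃ (p : Prog) (P : Polynomial ℕ), ∀ i, ∃ t, Run p (enc (c i)) (enc (e i)) t ∧ t ≤ P.eval (sz i)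

namespace PolyBdd

variable {ι κ : Type} {sz f g : ι → ℕ}

theorem of_le (h : ∀ i, f i ≤ sz i) : PolyBdd sz f := ⟨.X, fun i => by simpa using h i⟩

theorem of_le_const (m : ℕ) (h : ∀ i, f i ≤ m) : PolyBdd sz f :=
  ⟨.C m, fun i => by simpa using h i⟩

theorem reindex (h : PolyBdd sz f) (r : κ → ι) : PolyBdd (fun x => sz (r x)) fun x => f (r x) :=
  h.imp fun _ hP x => hP (r x)

end PolyBdd

theorem eval_mono (P : Polynomial ℕ) {a b : ℕ} (h : a ≤ b) : P.eval a ≤ P.eval b := by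
  rw [Polynomial.eval_eq_sum, Polynomial.eval_eq_sum]
  exact Finset.sum_le_sum fun i _ => Nat.mul_le_mul_left _ (Nat.pow_le_pow_left h i)

/-! ### Closure rules for polynomial-time computable families -/

namespace PolyTime

variable {ι κ γ α β σ δ : Type} [Enc γ] [Enc α] [Enc β] [Enc σ] [Enc δ] {sz : ι → ℕ} {c : ι → γ}

theorem of_prim (o : Prim) {e : ι → α} (h : ∀ i, o.eval (enc (c i)) = enc (e i)) :
    PolyTime sz c e :=
  ⟨.prim o, 1, fun i => ⟨1, h i ▸ Run.prim o _, by simp⟩⟩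

/-- Programs see only encodings, so values of different types may be exchanged: a pair for a cons
cell, a unary numeral for a list of units, a pair of tables for an encoded instance. -/
theorem of_enc_eq {a : ι → α} {b : ι → β} (h : PolyTime sz c a) (hab : ∀ i, enc (b i) = enc (a i)) :
    PolyTime sz c b := by
  obtain ⟨p, P, h⟩ := h
  exact ⟨p, P, fun i => by rw [hab]; exact h i⟩

theorem congr {a b : ι → α} (h : PolyTime sz c a) (hab : ∀ i, b i = a i) : PolyTime sz c b :=
  h.of_enc_eq fun i => by rw [hab]

/-- Both running times are measured in `sz i`, not in the size of the intermediate value, so the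
polynomials are added rather than composed. -/
theorem comp {a : ι → α} {e : ι → β} (h₁ : PolyTime sz c a) (h₂ : PolyTime sz a e) :
    PolyTime sz c e := by
  obtain ⟨p, P, hp⟩ := h₁
  obtain ⟨q, Q, hq⟩ := h₂
  refine ⟨.seq p q, P + Q + 1, fun i => ?_⟩
  obtain ⟨s, hs, hs'⟩ := hp i
  obtain ⟨t, ht, ht'⟩ := hq i
  exact ⟨_, hs.seq ht, by simp; omega⟩

theorem prod {a : ι → α} {b : ι → β} (h₁ : PolyTime sz c a) (h₂ : PolyTime sz c b) :
    PolyTime sz c fun i => (a i, b i) := by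
  obtain ⟨p, P, hp⟩ := h₁
  obtain ⟨q, Q, hq⟩ := h₂
  refine ⟨.pair p q, P + Q + 1, fun i => ?_⟩
  obtain ⟨s, hs, hs'⟩ := hp i
  obtain ⟨t, ht, ht'⟩ := hq i
  exact ⟨_, hs.pair ht, by simp; omega⟩

theorem self : PolyTime sz c c := of_prim .id fun _ => rfl

theorem fst {a : ι → α × β} (h : PolyTime sz c a) : PolyTime sz c fun i => (a i).1 :=
  h.comp (of_prim .fst fun _ => rfl)

theorem snd {a : ι → α × β} (h : PolyTime sz c a) : PolyTime sz c fun i => (a i).2 :=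
  h.comp (of_prim .snd fun _ => rfl)

theorem reindex {e : ι → α} (h : PolyTime sz c e) (r : κ → ι) :
    PolyTime (fun x => sz (r x)) (fun x => c (r x)) fun x => e (r x) := by
  obtain ⟨p, P, h⟩ := h
  exact ⟨p, P, fun x => h (r x)⟩

/-- Weakening: an additional variable. -/
theorem wk {p : ι × δ → Prop} {e : ι → α} (h : PolyTime sz c e) :
    PolyTime (fun x : {x : ι × δ // p x} => sz x.1.1) (fun x => (c x.1.1, x.1.2))
      fun x => e x.1.1 :=
  self.fst.comp (h.reindex _)

/-- The most recent variable. -/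
theorem var {e : ι → δ} : PolyTime sz (fun x => (c x, e x)) e := self.snd

/-- The second most recent variable. -/
theorem var₁ {e : ι → δ} {a : ι → α} : PolyTime sz (fun x => ((c x, e x), a x)) e := self.fst.snd

theorem ite {b : ι → Bool} {x y : ι → α} (hb : PolyTime sz c b) (hx : PolyTime sz c x)
    (hy : PolyTime sz c y) : PolyTime sz c fun i => if b i then x i else y i := by
  obtain ⟨r, R, hr⟩ := hb
  obtain ⟨p, P, hp⟩ := hx
  obtain ⟨q, Q, hq⟩ := hy
  refine ⟨.cond r p q, R + P + Q + 1, fun i => ?_⟩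
  obtain ⟨u, hu, hu'⟩ := hr i
  obtain ⟨s, hs, hs'⟩ := hp i
  obtain ⟨t, ht, ht'⟩ := hq i
  cases h : b i with
  | true =>
    beta_reduce
    rw [h] at hu ⊢
    exact ⟨_, hu.cond_true (fun h => Data.noConfusion h) hs, by simp; omega⟩
  | false =>
    beta_reduce
    rw [h] at hu ⊢
    exact ⟨_, hu.cond_false ht, by simp; omega⟩

/-! ### Constants, Booleans, reals -/

theorem unit : PolyTime sz c fun _ => () := of_prim .nil fun _ => rfl

theorem nil : PolyTime sz c fun _ => ([] : List α) := of_prim .nil fun _ => rfl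

theorem cons {a : ι → α} {l : ι → List α} (ha : PolyTime sz c a) (hl : PolyTime sz c l) :
    PolyTime sz c fun i => a i :: l i :=
  (ha.prod hl).of_enc_eq fun _ => rfl

theorem bool (b : Bool) : PolyTime sz c fun _ => b := by
  cases b
  · exact of_prim .nil fun _ => rfl
  · exact (unit.prod unit).of_enc_eq fun _ => rfl

theorem succ {m : ι → ℕ} (h : PolyTime sz c m) : PolyTime sz c fun i => m i + 1 :=
  (unit.prod h).of_enc_eq fun _ => rfl

theorem nat (m : ℕ) : PolyTime sz c fun _ => m := by
  induction m with
  | zero => exact of_prim .nil fun _ => rfl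
  | succ m ih => exact ih.succ

theorem list_const (h : ∀ a : α, PolyTime sz c fun _ => a) (l : List α) :
    PolyTime sz c fun _ => l := by
  induction l with
  | nil => exact nil
  | cons a l ih => exact (h a).cons ih

theorem none : PolyTime sz c fun _ => (none : Option α) := of_prim .nil fun _ => rfl

theorem some {a : ι → α} (h : PolyTime sz c a) : PolyTime sz c fun i => some (a i) :=
  (h.prod unit).of_enc_eq fun _ => rfl

theorem not {a : ι → Bool} (ha : PolyTime sz c a) : PolyTime sz c fun i => !a i :=
  (ha.ite (bool false) (bool true)).congr fun i => by cases a i <;> rfl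

theorem and {a b : ι → Bool} (ha : PolyTime sz c a) (hb : PolyTime sz c b) :
    PolyTime sz c fun i => a i && b i :=
  (ha.ite hb (bool false)).congr fun i => by cases a i <;> rfl

theorem or {a b : ι → Bool} (ha : PolyTime sz c a) (hb : PolyTime sz c b) :
    PolyTime sz c fun i => a i || b i :=
  (ha.ite (bool true) hb).congr fun i => by cases a i <;> rfl

theorem real_zero : PolyTime sz c fun _ => (0 : ℝ) := of_prim .zero fun _ => rfl

theorem real_add {a b : ι → ℝ} (ha : PolyTime sz c a) (hb : PolyTime sz c b) :
    PolyTime sz c fun i => a i + b i :=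
  (ha.prod hb).comp (of_prim .add fun _ => rfl)

open Classical in
theorem real_le {a b : ι → ℝ} (ha : PolyTime sz c a) (hb : PolyTime sz c b) :
    PolyTime sz c fun i => decide (a i ≤ b i) :=
  (ha.prod hb).comp (of_prim .le fun _ => rfl)

/-! ### Options and lists -/

theorem option_elim {x : ι → Option α} {d : ι → β} {f : ι → α → β} (hx : PolyTime sz c x)
    (hd : PolyTime sz c d)
    (hf : PolyTime (fun y : {y : ι × α // x y.1 = Option.some y.2} => sz y.1.1)
      (fun y => (c y.1.1, y.1.2)) fun y => f y.1.1 y.1.2) :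
    PolyTime sz c fun i => (x i).elim (d i) (f i) := by
  obtain ⟨r, R, hr⟩ := hx
  obtain ⟨p, P, hp⟩ := hd
  obtain ⟨q, Q, hq⟩ := hf
  refine ⟨.cond r (.seq (.pair (.prim .id) (.seq r (.prim .fst))) q) p, R + P + R + Q + 7,
    fun i => ?_⟩
  obtain ⟨u, hu, hu'⟩ := hr i
  obtain ⟨s, hs, hs'⟩ := hp i
  cases h : x i with
  | none =>
    beta_reduce
    rw [h] at hu ⊢
    exact ⟨_, hu.cond_false hs, by simp; omega⟩
  | some a =>
    obtain ⟨t, ht, ht'⟩ := hq ⟨(i, a), h⟩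
    beta_reduce
    rw [h] at hu ⊢
    exact ⟨_, hu.cond_true (fun h => Data.noConfusion h)
      (((Run.prim .id _).pair (hu.seq (Run.prim .fst _))).seq ht), by simp at ht' ⊢; omega⟩

theorem tail {l : ι → List α} (h : PolyTime sz c l) : PolyTime sz c fun i => (l i).tail :=
  h.comp (of_prim .snd fun i => by cases l i <;> rfl)

theorem headD {l : ι → List α} {d : ι → α} (hl : PolyTime sz c l) (hd : PolyTime sz c d) :
    PolyTime sz c fun i => (l i).headD (d i) := by
  obtain ⟨p, P, hp⟩ := hl
  obtain ⟨q, Q, hq⟩ := hd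
  refine ⟨.cond p (.seq p (.prim .fst)) q, P + P + Q + 3, fun i => ?_⟩
  obtain ⟨s, hs, hs'⟩ := hp i
  obtain ⟨t, ht, ht'⟩ := hq i
  cases h : l i with
  | nil =>
    beta_reduce
    rw [h] at hs ⊢
    exact ⟨_, hs.cond_false ht, by simp; omega⟩
  | cons a l =>
    beta_reduce
    rw [h] at hs ⊢
    exact ⟨_, hs.cond_true (fun h => Data.noConfusion h) (hs.seq (Run.prim .fst _)),
      by simp; omega⟩

theorem isEmpty {l : ι → List α} (hl : PolyTime sz c l) : PolyTime sz c fun i => (l i).isEmpty := by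
  obtain ⟨p, P, hp⟩ := hl
  obtain ⟨q, Q, hq⟩ := bool (sz := sz) (c := c) true
  refine ⟨.cond p (.prim .nil) q, P + Q + 2, fun i => ?_⟩
  obtain ⟨s, hs, hs'⟩ := hp i
  obtain ⟨t, ht, ht'⟩ := hq i
  cases h : l i with
  | nil =>
    beta_reduce
    rw [h] at hs ⊢
    exact ⟨_, hs.cond_false ht, by simp; omega⟩
  | cons a l =>
    beta_reduce
    rw [h] at hs ⊢
    exact ⟨_, hs.cond_true (fun h => Data.noConfusion h) (Run.prim .nil _),
      by simp; omega⟩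

/-- The only rule that uses `loop`. The loop carries the context, the accumulator and the remaining
list. The step need only be fast on accumulators satisfying `Inv`, which is how accumulators are
kept polynomially bounded. -/
theorem foldl {L : ι → List α} {s₀ : ι → σ} {f : ι → σ → α → σ} (Inv : ι → σ → Prop)
    (h₀ : ∀ i, Inv i (s₀ i)) (hInv : ∀ i s a, Inv i s → a ∈ L i → Inv i (f i s a))
    (hlen : PolyBdd sz fun i => (L i).length) (hL : PolyTime sz c L) (hs : PolyTime sz c s₀)
    (hf : PolyTime (fun x : {x : ι × σ × α // Inv x.1 x.2.1 ∧ x.2.2 ∈ L x.1} => sz x.1.1)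
      (fun x => (c x.1.1, x.1.2)) fun x => f x.1.1 x.1.2.1 x.1.2.2) :
    PolyTime sz c fun i => (L i).foldl (f i) (s₀ i) := by
  suffices h : PolyTime sz (fun i => (c i, s₀ i, L i))
      (fun i => (c i, (L i).foldl (f i) (s₀ i), ([] : List α))) from
    ((self.prod (hs.prod hL)).comp h).snd.fst
  obtain ⟨Q, hQ⟩ := hlen
  obtain ⟨p, P, hp⟩ := hf
  let sn : Prog := .prim .snd
  let fs : Prog := .prim .fst
  -- A round costs 24 steps besides the call of `p`, for which `27` is ample; the `4` pays for the
  -- last, failing test.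
  refine ⟨.loop (.seq sn sn) (.pair fs (.pair (.seq (.pair fs (.pair (.seq sn fs)
    (.seq (.seq sn sn) fs))) p) (.seq (.seq sn sn) sn))), Q * (P + 27) + 4, fun i => ?_⟩
  have key : ∀ (l : List α) (s : σ), Inv i s → (∀ a ∈ l, a ∈ L i) →
      ∃ t, Run (.loop (.seq sn sn) (.pair fs (.pair (.seq (.pair fs (.pair (.seq sn fs)
        (.seq (.seq sn sn) fs))) p) (.seq (.seq sn sn) sn)))) (enc (c i, s, l))
          (enc (c i, l.foldl (f i) s, ([] : List α))) t ∧
        t ≤ l.length * (P.eval (sz i) + 27) + 4 := by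
    intro l
    induction l with
    | nil =>
      intro s _ _
      exact ⟨_, Run.loop_stop ((Run.prim .snd _).seq (Run.prim .snd _)), by simp⟩
    | cons a l ih =>
      intro s hs hl
      obtain ⟨t, ht, ht'⟩ := hp ⟨(i, s, a), hs, hl a (by simp)⟩
      obtain ⟨u, hu, hu'⟩ := ih (f i s a) (hInv i s a hs (hl a (by simp)))
        fun b hb => hl b (by simp [hb])
      have h2 : ∀ x : γ × σ × List α, Run (.seq sn sn) (enc x) (enc x.2.2) 3 := fun x =>
        (Run.prim .snd _).seq (Run.prim .snd _)
      have h2' := h2 (c i, s, a :: l)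
      refine ⟨_, .loop_step h2' (fun h => Data.noConfusion h) ((Run.prim .fst _).pair
        ((((Run.prim .fst _).pair (((Run.prim .snd _).seq (Run.prim .fst _)).pair
          (h2'.seq (Run.prim .fst _)))).seq ht).pair (h2'.seq (Run.prim .snd _)))) hu, ?_⟩
      simp only [List.length_cons, add_mul, one_mul] at hu' ht' ⊢
      omega
  obtain ⟨t, ht, ht'⟩ := key (L i) (s₀ i) (h₀ i) fun _ h => h
  refine ⟨t, ht, ht'.trans ?_⟩
  simpa using Nat.mul_le_mul_right (P.eval (sz i) + 27) (hQ i)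

/-- Folding without an invariant. -/
theorem foldl' {L : ι → List α} {s₀ : ι → σ} {f : ι → σ → α → σ}
    (hlen : PolyBdd sz fun i => (L i).length) (hL : PolyTime sz c L) (hs : PolyTime sz c s₀)
    (hf : PolyTime (fun x : {x : ι × σ × α // True ∧ x.2.2 ∈ L x.1} => sz x.1.1)
      (fun x => (c x.1.1, x.1.2)) fun x => f x.1.1 x.1.2.1 x.1.2.2) :
    PolyTime sz c fun i => (L i).foldl (f i) (s₀ i) :=
  foldl (fun _ _ => True) (fun _ => trivial) (fun _ _ _ _ _ => trivial) hlen hL hs hf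

theorem reverse {l : ι → List α} (hlen : PolyBdd sz fun i => (l i).length) (h : PolyTime sz c l) :
    PolyTime sz c fun i => (l i).reverse :=
  (foldl' (f := fun _ s a => a :: s) hlen h nil (var.snd.cons var.fst)).congr fun i => by
    simp

theorem length {l : ι → List α} (hlen : PolyBdd sz fun i => (l i).length) (h : PolyTime sz c l) :
    PolyTime sz c fun i => (l i).length :=
  (foldl' (f := fun _ s _ => s + 1) hlen h (nat 0) var.fst.succ).congr fun i => by
    simp

theorem map {L : ι → List α} {f : ι → α → β}
    (hlen : PolyBdd sz fun i => (L i).length) (hL : PolyTime sz c L)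
    (hf : PolyTime (fun x : {x : ι × α // x.2 ∈ L x.1} => sz x.1.1)
      (fun x => (c x.1.1, x.1.2)) fun x => f x.1.1 x.1.2) :
    PolyTime sz c fun i => (L i).map (f i) := by
  have h1 : PolyTime sz c fun i => (L i).foldl (fun s a => f i a :: s) [] := by
    refine foldl' hlen hL nil (PolyTime.cons ?_ var.fst)
    exact (wk self).prod var.snd |>.comp
      (hf.reindex fun x : {x : ι × List β × α // True ∧ x.2.2 ∈ L x.1} =>
        ⟨(x.1.1, x.1.2.2), x.2.2⟩)
  have h2 : ∀ i, (L i).foldl (fun s a => f i a :: s) [] = ((L i).map (f i)).reverse := by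
    intro i
    have : ∀ (l : List α) (s : List β),
        l.foldl (fun s a => f i a :: s) s = (l.map (f i)).reverse ++ s := by
      intro l
      induction l with
      | nil => simp
      | cons a l ih => intro s; simp [ih]
    simp [this]
  refine (reverse ?_ (h1.congr fun i => (h2 i).symm)).congr fun i => by simp
  simp [hlen]

theorem filter {L : ι → List α} {f : ι → α → Bool}
    (hlen : PolyBdd sz fun i => (L i).length) (hL : PolyTime sz c L)
    (hf : PolyTime (fun x : {x : ι × α // x.2 ∈ L x.1} => sz x.1.1)
      (fun x => (c x.1.1, x.1.2)) fun x => f x.1.1 x.1.2) :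
    PolyTime sz c fun i => (L i).filter (f i) := by
  have h1 : PolyTime sz c fun i => (L i).foldl (fun s a => if f i a then a :: s else s) [] := by
    refine foldl' hlen hL nil (PolyTime.ite ?_ (var.snd.cons var.fst) var.fst)
    exact (wk self).prod var.snd |>.comp
      (hf.reindex fun x : {x : ι × List α × α // True ∧ x.2.2 ∈ L x.1} =>
        ⟨(x.1.1, x.1.2.2), x.2.2⟩)
  have h2 : ∀ i, (L i).foldl (fun s a => if f i a then a :: s else s) [] =
      ((L i).filter (f i)).reverse := by
    intro i
    have : ∀ (l : List α) (s : List α),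
        l.foldl (fun s a => if f i a then a :: s else s) s = (l.filter (f i)).reverse ++ s := by
      intro l
      induction l with
      | nil => simp
      | cons a l ih => intro s; by_cases h : f i a <;> simp [ih, h]
    simpa using this (L i) []
  refine (reverse ?_ (h1.congr fun i => (h2 i).symm)).congr fun i => by simp
  obtain ⟨P, hP⟩ := hlen
  exact ⟨P, fun i => by simpa using (List.length_filter_le _ _).trans (hP i)⟩

theorem any {L : ι → List α} {f : ι → α → Bool}
    (hlen : PolyBdd sz fun i => (L i).length) (hL : PolyTime sz c L)
    (hf : PolyTime (fun x : {x : ι × α // x.2 ∈ L x.1} => sz x.1.1)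
      (fun x => (c x.1.1, x.1.2)) fun x => f x.1.1 x.1.2) :
    PolyTime sz c fun i => (L i).any (f i) :=
  (filter hlen hL hf).isEmpty.not.congr fun i => by
    rw [Bool.eq_iff_iff]; simp

/-- A unary numeral has the encoding of a list of units, so it can itself drive a fold that takes
tails. -/
theorem drop {l : ι → List α} {m : ι → ℕ} (hl : PolyTime sz c l) (hm : PolyTime sz c m)
    (hb : PolyBdd sz m) : PolyTime sz c fun i => (l i).drop (m i) := by
  have h1 : PolyTime sz c fun i => List.replicate (m i) () := hm.of_enc_eq fun i => (enc_nat _).symm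
  refine (foldl' (f := fun _ s _ => s.tail) (by simpa using hb) h1 hl var.fst.tail).congr fun i => ?_
  generalize m i = k
  generalize l i = l
  induction k generalizing l with
  | zero => simp
  | succ k ih => simp [List.replicate_succ, ← ih]

theorem getD {l : ι → List α} {m : ι → ℕ} {d : ι → α} (hl : PolyTime sz c l)
    (hm : PolyTime sz c m) (hd : PolyTime sz c d) (hb : PolyBdd sz m) :
    PolyTime sz c fun i => (l i).getD (m i) (d i) :=
  ((hl.drop hm hb).headD hd).congr fun i => by
    simp [List.getD_eq_getElem?_getD, List.headD_eq_head?_getD]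

/-- Dropping `b` units from a list of `a` units leaves nothing exactly when `a ≤ b`. Only `b`
controls the number of rounds, so only `b` needs a bound. -/
theorem nat_le {a b : ι → ℕ} (ha : PolyTime sz c a) (hb : PolyTime sz c b) (hbd : PolyBdd sz b) :
    PolyTime sz c fun i => decide (a i ≤ b i) := by
  have h1 : PolyTime sz c fun i => List.replicate (a i) () := ha.of_enc_eq fun i => (enc_nat _).symm
  exact (h1.drop hb hbd).isEmpty.congr fun i => by
    rw [Bool.eq_iff_iff]; simp [Nat.sub_eq_zero_iff_le]

theorem nat_eq {a b : ι → ℕ} (ha : PolyTime sz c a) (hb : PolyTime sz c b) (had : PolyBdd sz a)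
    (hbd : PolyBdd sz b) : PolyTime sz c fun i => decide (a i = b i) :=
  ((nat_le ha hb hbd).and (nat_le hb ha had)).congr fun i => by
    rw [Bool.eq_iff_iff]; simp [le_antisymm_iff]

theorem range {m : ι → ℕ} (hm : PolyTime sz c m) (hb : PolyBdd sz m) :
    PolyTime sz c fun i => List.range (m i) := by
  have h1 : PolyTime sz c fun i => List.replicate (m i) () := hm.of_enc_eq fun i => (enc_nat _).symm
  have h2 : PolyTime sz c fun i => (List.replicate (m i) ()).foldl
      (fun (s : ℕ × List ℕ) _ => (s.1 + 1, s.1 :: s.2)) (0, []) :=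
    foldl' (by simpa using hb) h1 ((nat 0).prod nil)
      (var.fst.fst.succ.prod (var.fst.fst.cons var.fst.snd))
  have h3 : ∀ k, (List.replicate k ()).foldl
      (fun (s : ℕ × List ℕ) _ => (s.1 + 1, s.1 :: s.2)) (0, []) = (k, (List.range k).reverse) := by
    intro k
    induction k with
    | zero => rfl
    | succ k ih => rw [List.replicate_succ', List.foldl_append, ih]; simp [List.range_succ]
  refine (reverse ?_ h2.snd).congr fun i => by rw [h3]; simp
  simpa [h3] using hb

end PolyTime

/-! ## The algorithm -/

/-- The entry of a matrix that is stored as the list of its rows. -/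
def lookup {α : Type} (A : List (List α)) (d : α) (u v : ℕ) : α := (A.getD u []).getD v d

/-- Add to `B` the elements of `R` that distinguish two elements of `B`. -/
def growStep (A : List (List Bool)) (R B : List ℕ) : List ℕ :=
  R.filter fun w => B.any (fun b => decide (b = w)) ||
    (B.any (fun b => lookup A false w b) && B.any fun b => !lookup A false w b)

/-- The smallest module of the graph on `R` that contains `u` and `v`. -/
def moduleClosure (A : List (List Bool)) (R : List ℕ) (u v : ℕ) : List ℕ :=
  R.foldl (fun B _ => growStep A R B) (R.filter fun w => decide (w = u) || decide (w = v))

/-- A module of the graph on `R` which is smallest among those with at least two elements. -/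
def minModule (A : List (List Bool)) (R : List ℕ) : List ℕ :=
  R.foldl (fun best u => R.foldl (fun best v =>
    if !decide (u = v) && decide ((moduleClosure A R u v).length ≤ best.length)
    then moduleClosure A R u v else best) best) R

theorem growStep_sublist (A : List (List Bool)) (R B : List ℕ) : (growStep A R B).Sublist R :=
  List.filter_sublist

theorem foldl_invariant {α σ : Type*} {f : σ → α → σ} {p : σ → Prop} (l : List α) {s : σ}
    (hs : p s) (h : ∀ s a, a ∈ l → p s → p (f s a)) : p (l.foldl f s) := by
  induction l generalizing s with
  | nil => exact hs
  | cons a l ih => exact ih (h s a (by simp) hs) fun s b hb => h s b (by simp [hb])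

theorem moduleClosure_sublist (A : List (List Bool)) (R : List ℕ) (u v : ℕ) :
    (moduleClosure A R u v).Sublist R :=
  foldl_invariant (p := fun B : List ℕ => B.Sublist R) R List.filter_sublist
    fun s _ _ _ => growStep_sublist A R s

theorem minModule_step_sublist (A : List (List Bool)) (R : List ℕ) (u : ℕ) {best : List ℕ}
    (hb : best.Sublist R) : (R.foldl (fun best v =>
    if !decide (u = v) && decide ((moduleClosure A R u v).length ≤ best.length)
    then moduleClosure A R u v else best) best).Sublist R := by
  refine foldl_invariant (p := fun B : List ℕ => B.Sublist R) R hb fun s v _ hs => ?_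
  split
  · exact moduleClosure_sublist A R u v
  · exact hs

theorem minModule_sublist (A : List (List Bool)) (R : List ℕ) : (minModule A R).Sublist R :=
  foldl_invariant (p := fun B : List ℕ => B.Sublist R) R (List.Sublist.refl R)
    fun _ u _ hs => minModule_step_sublist A R u hs

/-! ### Running time of the search for a smallest module -/

namespace PolyTime

variable {ι γ : Type} [Enc γ] {sz : ι → ℕ} {c : ι → γ} {A : ι → List (List Bool)}
  {R B : ι → List ℕ}

theorem lookup {α : Type} [Enc α] {A : ι → List (List α)} {d : ι → α} {u v : ι → ℕ}
    (hA : PolyTime sz c A) (hd : PolyTime sz c d)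
    (hu : PolyTime sz c u) (hv : PolyTime sz c v) (hbu : PolyBdd sz u) (hbv : PolyBdd sz v) :
    PolyTime sz c fun i => lookup (A i) (d i) (u i) (v i) :=
  (hA.getD hu nil hbu).getD hv hd hbv

theorem growStep (hA : PolyTime sz c A) (hR : PolyTime sz c R) (hB : PolyTime sz c B)
    (hbR : ∀ i, ∀ u ∈ R i, u ≤ sz i) (hlR : ∀ i, (R i).length ≤ sz i)
    (hBR : ∀ i, (B i).Sublist (R i)) :
    PolyTime sz c fun i => growStep (A i) (R i) (B i) := by
  have hbB : ∀ i, ∀ u ∈ B i, u ≤ sz i := fun i u hu => hbR i u ((hBR i).subset hu)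
  have hlB : ∀ i, (B i).length ≤ sz i := fun i => (hBR i).length_le.trans (hlR i)
  have hl : PolyTime
      (fun x : {x : {x : ι × ℕ // x.2 ∈ R x.1} × ℕ // x.2 ∈ B x.1.1.1} => sz x.1.1.1.1)
      (fun x => ((c x.1.1.1.1, x.1.1.1.2), x.1.2))
      fun x => MaxPartial.lookup (A x.1.1.1.1) false x.1.1.1.2 x.1.2 :=
    hA.wk.wk.lookup (bool false) var₁ var (.of_le fun x => hbR _ _ x.1.1.2)
      (.of_le fun x => hbB _ _ x.2)
  refine filter (.of_le hlR) hR (.or ?_ (.and ?_ ?_))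
  · exact any (.of_le fun x => hlB _) hB.wk
      (nat_eq var var₁ (.of_le fun x => hbB _ _ x.2) (.of_le fun x => hbR _ _ x.1.1.2))
  · exact any (.of_le fun x => hlB _) hB.wk hl
  · exact any (.of_le fun x => hlB _) hB.wk hl.not

theorem moduleClosure (hA : PolyTime sz c A) (hR : PolyTime sz c R) {u v : ι → ℕ}
    (hu : PolyTime sz c u) (hv : PolyTime sz c v)
    (hbu : PolyBdd sz u) (hbv : PolyBdd sz v)
    (hbR : ∀ i, ∀ u ∈ R i, u ≤ sz i) (hlR : ∀ i, (R i).length ≤ sz i) :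
    PolyTime sz c fun i => moduleClosure (A i) (R i) (u i) (v i) := by
  refine foldl (fun i B => B.Sublist (R i)) (fun i => List.filter_sublist)
    (fun i B _ _ _ => growStep_sublist _ _ _) (.of_le hlR) hR ?_ ?_
  · exact filter (.of_le hlR) hR (.or
      (nat_eq var hu.wk (.of_le fun x => hbR _ _ x.2) (hbu.reindex _))
      (nat_eq var hv.wk (.of_le fun x => hbR _ _ x.2) (hbv.reindex _)))
  · exact growStep hA.wk hR.wk var.fst (fun x => hbR _) (fun x => hlR _) fun x => x.2.1

theorem minModule (hA : PolyTime sz c A) (hR : PolyTime sz c R)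
    (hbR : ∀ i, ∀ u ∈ R i, u ≤ sz i) (hlR : ∀ i, (R i).length ≤ sz i) :
    PolyTime sz c fun i => minModule (A i) (R i) := by
  refine foldl (fun i B => B.Sublist (R i)) (fun i => .refl _)
    (fun i B u hB _ => minModule_step_sublist _ _ _ hB) (.of_le hlR) hR hR ?_
  refine foldl (fun i B => B.Sublist (R i.1.1)) (fun i => i.2.1)
    (fun i B v hB _ => ?_) (.of_le fun x => hlR _) hR.wk var.fst ?_
  · split
    · exact moduleClosure_sublist _ _ _ _
    · exact hB
  · have hu := PolyBdd.of_le (sz := fun x : {x : {x : ι × List ℕ × ℕ //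
        x.2.1.Sublist (R x.1) ∧ x.2.2 ∈ R x.1} × List ℕ × ℕ //
        x.2.1.Sublist (R x.1.1.1) ∧ x.2.2 ∈ R x.1.1.1} => sz x.1.1.1.1)
        (f := fun x => x.1.1.1.2.2) fun x => hbR _ _ x.1.1.2.2
    have hv := PolyBdd.of_le (sz := fun x : {x : {x : ι × List ℕ × ℕ //
        x.2.1.Sublist (R x.1) ∧ x.2.2 ∈ R x.1} × List ℕ × ℕ //
        x.2.1.Sublist (R x.1.1.1) ∧ x.2.2 ∈ R x.1.1.1} => sz x.1.1.1.1)
        (f := fun x => x.1.2.2) fun x => hbR _ _ x.2.2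
    have hc := moduleClosure hA.wk.wk hR.wk.wk var₁.snd var.snd hu hv (fun x => hbR _)
      fun x => hlR _
    have hlc : PolyBdd (fun x : {x : {x : ι × List ℕ × ℕ //
        x.2.1.Sublist (R x.1) ∧ x.2.2 ∈ R x.1} × List ℕ × ℕ //
        x.2.1.Sublist (R x.1.1.1) ∧ x.2.2 ∈ R x.1.1.1} => sz x.1.1.1.1)
        fun x => (MaxPartial.moduleClosure (A x.1.1.1.1) (R x.1.1.1.1)
          x.1.1.1.2.2 x.1.2.2).length :=
      .of_le fun x => (moduleClosure_sublist _ _ _ _).length_le.trans (hlR _)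
    have hlb : PolyBdd (fun x : {x : {x : ι × List ℕ × ℕ //
        x.2.1.Sublist (R x.1) ∧ x.2.2 ∈ R x.1} × List ℕ × ℕ //
        x.2.1.Sublist (R x.1.1.1) ∧ x.2.2 ∈ R x.1.1.1} => sz x.1.1.1.1)
        fun x => x.1.2.1.length :=
      .of_le fun x => x.2.1.length_le.trans (hlR _)
    exact .ite (.and (.not (nat_eq var₁.snd var.snd hu hv))
      (nat_le (hc.length hlc) (var.fst.length hlb) hlb)) hc var.fst

end PolyTime

/-! ## Smallest modules -/

/-- `B` is a module of the graph that the matrix `A` defines on `R`. -/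
def IsListModule (A : List (List Bool)) (R B : List ℕ) : Prop :=
  ∀ w ∈ R, w ∉ B → ∀ a ∈ B, ∀ b ∈ B, lookup A false w a = lookup A false w b

variable {A : List (List Bool)} {R : List ℕ}

theorem mem_growStep {B : List ℕ} {w : ℕ} : w ∈ growStep A R B ↔ w ∈ R ∧
    (w ∈ B ∨ (∃ a ∈ B, lookup A false w a = true) ∧ ∃ b ∈ B, lookup A false w b = false) := by
  simp [growStep]

/-- A vertex that distinguishes two elements of the module `C` cannot lie outside `C`. -/
theorem growStep_subset_of_isListModule {B C : List ℕ} (hC : IsListModule A R C) (h : B ⊆ C) :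
    growStep A R B ⊆ C := by
  intro w hw
  rw [mem_growStep] at hw
  obtain ⟨hwR, hw | ⟨⟨a, ha, ha'⟩, b, hb, hb'⟩⟩ := hw
  · exact h hw
  · by_contra hwC
    have := hC w hwR hwC a (h ha) b (h hb)
    simp [ha', hb'] at this

theorem growStep_isListModule {B : List ℕ} (h : growStep A R B ⊆ B) : IsListModule A R B := by
  intro w hw hwB a ha b hb
  by_contra hab
  apply hwB
  apply h
  rw [mem_growStep]
  refine ⟨hw, .inr ?_⟩
  cases h1 : lookup A false w a <;> cases h2 : lookup A false w b
  · simp [h1, h2] at hab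
  · exact ⟨⟨b, hb, h2⟩, a, ha, h1⟩
  · exact ⟨⟨a, ha, h1⟩, b, hb, h2⟩
  · simp [h1, h2] at hab

theorem moduleClosure_subset {B : List ℕ} {u v : ℕ} (hB : IsListModule A R B) (hu : u ∈ B)
    (hv : v ∈ B) : moduleClosure A R u v ⊆ B := by
  refine foldl_invariant (p := fun C => C ⊆ B) R ?_
    fun s _ _ hs => growStep_subset_of_isListModule hB hs
  intro w hw
  simp only [List.mem_filter, Bool.or_eq_true, decide_eq_true_eq] at hw
  rcases hw.2 with rfl | rfl <;> assumption

theorem subset_growStep {B : List ℕ} (h : B ⊆ R) : B ⊆ growStep A R B := fun _ hw =>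
  mem_growStep.2 ⟨h hw, .inl hw⟩

theorem mem_moduleClosure {u v w : ℕ} (hw : w ∈ R) (h : w = u ∨ w = v) :
    w ∈ moduleClosure A R u v := by
  refine (foldl_invariant (p := fun C => C.Sublist R ∧ w ∈ C) R ⟨List.filter_sublist, ?_⟩
    fun s _ _ hs => ⟨growStep_sublist _ _ _, subset_growStep hs.1.subset hs.2⟩).2
  simpa [hw] using h

/-- A round that does not start from a fixed point adds an element. Hence `R.length` rounds either
meet a fixed point, which is a module, or fill up all of `R`. -/
theorem moduleClosure_isListModule (hR : R.Nodup) (u v : ℕ) :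
    IsListModule A R (moduleClosure A R u v) := by
  have key : ∀ (l : List ℕ) (B : List ℕ), B.Sublist R →
      growStep A R (l.foldl (fun B _ => growStep A R B) B) ⊆
        l.foldl (fun B _ => growStep A R B) B ∨
      B.length + l.length ≤ (l.foldl (fun B _ => growStep A R B) B).length := by
    intro l
    induction l with
    | nil => intro B _; right; simp
    | cons x l ih =>
      intro B hB
      rw [List.foldl_cons]
      by_cases hgB : growStep A R B ⊆ B
      -- A list closed under `growStep` is a module, and one more round keeps it closed, so all
      -- later rounds do too.
      · left
        refine (foldl_invariant (p := fun C => C.Sublist R ∧ growStep A R C ⊆ C) l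
          ⟨growStep_sublist _ _ _, ?_⟩ fun C _ _ hC => ⟨growStep_sublist _ _ _, ?_⟩).2
        · exact growStep_subset_of_isListModule
            (growStep_isListModule (fun w hw =>
              growStep_subset_of_isListModule (growStep_isListModule hgB) hgB hw |>
                fun h => subset_growStep hB.subset h)) (List.Subset.refl _)
        · exact growStep_subset_of_isListModule
            (growStep_isListModule (fun w hw =>
              growStep_subset_of_isListModule (growStep_isListModule hC.2) hC.2 hw |>
                fun h => subset_growStep hC.1.subset h)) (List.Subset.refl _)
      · refine (ih _ (growStep_sublist A R B)).imp_right fun h => ?_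
        have h1 : B.length < (growStep A R B).length := by
          have hsub : B.Subperm (growStep A R B) :=
            List.subperm_of_subset (hB.nodup hR) (subset_growStep hB.subset)
          refine lt_of_le_of_ne hsub.length_le fun he => hgB ?_
          exact (hsub.perm_of_length_le he.ge).symm.subset
        rw [List.length_cons]
        omega
  apply growStep_isListModule
  rcases key R (R.filter fun w => decide (w = u) || decide (w = v)) List.filter_sublist with h | h
  · exact h
  · have h1 : moduleClosure A R u v = R :=
      (moduleClosure_sublist A R u v).eq_of_length_le (le_trans (by omega) h)
    rw [h1]
    exact (growStep_sublist A R R).subset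

theorem foldl_length_le {α β : Type*} (f : List β → α → List β) (l : List α)
    (hf : ∀ s a, a ∈ l → (f s a).length ≤ s.length) (s : List β) :
    (l.foldl f s).length ≤ s.length := by
  induction l generalizing s with
  | nil => exact le_rfl
  | cons a l ih =>
    exact (ih (fun s b hb => hf s b (by simp [hb])) _).trans (hf s a (by simp))

theorem foldl_length_le_of_mem {α β : Type*} (f : List β → α → List β) (l : List α)
    (hf : ∀ s a, a ∈ l → (f s a).length ≤ s.length) {a : α} (ha : a ∈ l) {m : ℕ}
    (hm : ∀ s, (f s a).length ≤ m) (s : List β) :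
    (l.foldl f s).length ≤ m := by
  induction l generalizing s with
  | nil => simp at ha
  | cons b l ih =>
    have hl : ∀ s a, a ∈ l → (f s a).length ≤ s.length := fun s b hb => hf s b (by simp [hb])
    rcases List.mem_cons.1 ha with rfl | ha
    · exact (foldl_length_le f l hl _).trans (hm s)
    · exact ih hl ha _

theorem minModule_length_le {u v : ℕ} (hu : u ∈ R) (hv : v ∈ R) (huv : u ≠ v) :
    (minModule A R).length ≤ (moduleClosure A R u v).length := by
  have h1 : ∀ u s v, v ∈ R →
      (if !decide (u = v) && decide ((moduleClosure A R u v).length ≤ s.length)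
        then moduleClosure A R u v else s).length ≤ s.length := by
    intro u s v _
    split
    · simp_all
    · exact le_rfl
  refine foldl_length_le_of_mem _ R (fun s u _ => foldl_length_le _ R (h1 u) s) hu (fun s => ?_) _
  refine foldl_length_le_of_mem _ R (h1 u) hv (fun s => ?_) s
  split
  · exact le_rfl
  · simp_all; omega

/-- The search returns its start value `R` or one of its candidates. The value `R` survives when `R`
has fewer than two elements. -/
theorem minModule_induction {p : List ℕ → Prop} (h0 : p R)
    (h : ∀ u ∈ R, ∀ v ∈ R, u ≠ v → p (moduleClosure A R u v)) : p (minModule A R) := by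
  refine foldl_invariant R h0 fun s u hu hs => foldl_invariant R hs fun s v hv hs => ?_
  split
  · simp_all
  · exact hs

theorem minModule_isListModule (hR : R.Nodup) : IsListModule A R (minModule A R) :=
  minModule_induction (fun _ hw hw' => absurd hw hw')
    fun u _ v _ _ => moduleClosure_isListModule hR u v

theorem two_le_length_minModule (hR : 2 ≤ R.length) : 2 ≤ (minModule A R).length := by
  refine minModule_induction (p := fun B => 2 ≤ B.length) hR fun u hu v hv huv => ?_
  have : [u, v].Subperm (moduleClosure A R u v) :=
    List.subperm_of_subset (by simp [huv]) (by
      simp [List.cons_subset, mem_moduleClosure hu, mem_moduleClosure hv])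
  exact this.length_le

theorem minModule_ne_nil (hR : R ≠ []) : minModule A R ≠ [] :=
  minModule_induction (p := fun B => B ≠ []) hR fun _ hu _ _ _ => List.ne_nil_of_mem (mem_moduleClosure hu (.inl rfl))

/-- Two elements of `B` have their closure inside `B`, and that closure was one of the candidates.
-/
theorem minModule_minimal {B : List ℕ} (hR : R.Nodup) (hB : B.Nodup) (hBR : B ⊆ R)
    (hm : IsListModule A R B) (h2 : 2 ≤ B.length) : (minModule A R).length ≤ B.length := by
  match B, h2 with
  | u :: v :: B, _ =>
    have huv : u ≠ v := by rintro rfl; simp at hB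
    refine (minModule_length_le (hBR (by simp)) (hBR (by simp)) huv).trans ?_
    exact (List.subperm_of_subset ((moduleClosure_sublist A R u v).nodup hR)
      (moduleClosure_subset hm (by simp) (by simp))).length_le

/-- The graph induced on a list of vertices. -/
def subG (G : SimpleGraph ℕ) (B : List ℕ) : SimpleGraph (Fin B.length) :=
  G.comap fun j => B[j]

/-- A proper module of the induced graph would be a module of the graph on `R` with at least two
elements, smaller than the smallest one. -/
theorem subG_minModule_isPrime {G : SimpleGraph ℕ} (hR : R.Nodup)
    (hA : ∀ u ∈ R, ∀ v ∈ R, lookup A false u v = true ↔ G.Adj u v) :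
    IsPrimeGraph (subG G (minModule A R)) := by
  intro C hC ⟨h2, hlt⟩
  have hsub := minModule_sublist A R
  have hnd := hsub.nodup hR
  generalize hB : minModule A R = B at *
  have hinj : Function.Injective fun j : Fin B.length => B[j] := fun a b h =>
    Fin.ext ((List.Nodup.getElem_inj_iff hnd).1 h)
  let D : List ℕ := (C.image fun j => B[j]).toList
  have hD : D.length = C.card := by
    rw [Finset.length_toList, Finset.card_image_of_injective _ hinj]
  have hmem : ∀ w, w ∈ D ↔ ∃ j ∈ C, B[j] = w := fun w => by simp [D]
  have hDB : ∀ w ∈ D, w ∈ B := by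
    intro w hw
    obtain ⟨j, -, rfl⟩ := (hmem w).1 hw
    exact List.getElem_mem _
  have hDm : IsListModule A R D := by
    intro w hw hwD a ha b hb
    -- Inside `B` the module property of `C` applies; outside `B`, that of `B` itself.
    by_cases hwB : w ∈ B
    · obtain ⟨j, hj, rfl⟩ := List.getElem_of_mem hwB
      obtain ⟨x, hx, rfl⟩ := (hmem a).1 ha
      obtain ⟨y, hy, rfl⟩ := (hmem b).1 hb
      have hjC : (⟨j, hj⟩ : Fin B.length) ∉ C := fun h => hwD ((hmem _).2 ⟨_, h, rfl⟩)
      rw [Bool.eq_iff_iff, hA _ hw _ (hsub.subset (hDB _ ha)),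
        hA _ hw _ (hsub.subset (hDB _ hb))]
      rcases hC ⟨j, hj⟩ (by simpa using hjC) with h | h
      · exact iff_of_true (h x hx) (h y hy)
      · exact iff_of_false (h x hx) (h y hy)
    · have := minModule_isListModule (A := A) hR
      rw [hB] at this
      exact this w hw hwB a (hDB a ha) b (hDB b hb)
  have := minModule_minimal hR (Finset.nodup_toList _) (fun w hw => hsub.subset (hDB w hw)) hDm
    (hD ▸ h2)
  rw [hB, hD] at this
  omega

/-! ## Optimum colorings of a union of modules -/

section Merge

variable {V W : Type*} {G : SimpleGraph V} {H : SimpleGraph W} {rev : V → W → ℝ}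

/-- A partial coloring with domain in `X` and colors in `S`. -/
def IsColoringOn (G : SimpleGraph V) (H : SimpleGraph W) (X : Set V) (S : Finset W)
    (φ : V → Option W) : Prop :=
  IsPartialColoring G H φ ∧ ∀ v a, φ v = some a → v ∈ X ∧ a ∈ S

/-- A partial coloring of maximum revenue among those with domain in `X` and colors in `S`. -/
def IsOptimumOn [Fintype V] (G : SimpleGraph V) (H : SimpleGraph W) (rev : V → W → ℝ) (X : Set V)
    (S : Finset W) (φ : V → Option W) : Prop :=
  IsColoringOn G H X S φ ∧ ∀ ψ, IsColoringOn G H X S ψ → revenue rev ψ ≤ revenue rev φ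

/-- The graph on the sets of vertices of `H` in which two distinct sets are adjacent if they are
complete to each other. -/
def setGraph (H : SimpleGraph W) : SimpleGraph (Finset W) where
  Adj S T := S ≠ T ∧ ∀ a ∈ S, ∀ b ∈ T, H.Adj a b
  symm := ⟨fun _ _ h => ⟨h.1.symm, fun a ha b hb => (h.2 b hb a ha).symm⟩⟩
  loopless := ⟨fun _ h => h.1 rfl⟩

theorem IsColoringOn.eq_none {X : Set V} {S : Finset W} {φ : V → Option W}
    (h : IsColoringOn G H X S φ) {v : V} (hv : v ∉ X) : φ v = none :=
  Option.eq_none_iff_forall_ne_some.2 fun a ha => hv (h.2 v a ha).1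

theorem IsColoringOn.eq_none_of_empty {X : Set V} {φ : V → Option W}
    (h : IsColoringOn G H X ∅ φ) (v : V) : φ v = none :=
  Option.eq_none_iff_forall_ne_some.2 fun a ha => absurd (h.2 v a ha).2 (by simp)

open Classical in
/-- The restriction of a partial coloring to a set of vertices. -/
noncomputable def restrict (φ : V → Option W) (X : Set V) : V → Option W :=
  fun v => if v ∈ X then φ v else none

theorem restrict_eq_some {φ : V → Option W} {X : Set V} {v : V} {a : W} :
    restrict φ X v = some a ↔ v ∈ X ∧ φ v = some a := by
  simp [restrict]

variable [Fintype V] {J : Type*} [Fintype J] {X : J → Set V}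

theorem revenue_eq_sum_restrict (hX : Pairwise fun i j => Disjoint (X i) (X j))
    {φ : V → Option W} (hφ : ∀ v, (∀ j, v ∉ X j) → φ v = none) :
    revenue rev φ = ∑ j, revenue rev (restrict φ (X j)) := by
  unfold revenue
  rw [Finset.sum_comm]
  refine Finset.sum_congr rfl fun v _ => ?_
  by_cases h : ∃ j, v ∈ X j
  · obtain ⟨j, hj⟩ := h
    rw [Finset.sum_eq_single j]
    · simp [restrict, hj]
    · intro i _ hij
      have : v ∉ X i := fun hi => Set.disjoint_left.1 (hX hij) hi hj
      simp [restrict, this]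
    · simp
  · push Not at h
    simp [restrict, h, hφ v h]

theorem revenue_eq_zero {φ : V → Option W} (h : ∀ v, φ v = none) : revenue rev φ = 0 := by
  simp [revenue, h]

/-- Combine optimum colorings of disjoint modules, according to an optimum coloring of the
quotient graph by sets of colors. -/
theorem IsOptimumOn.merge [DecidableEq W] {K : ℕ} (e : Finset W ≃ Fin K) {Q : SimpleGraph J}
    (hX : Pairwise fun i j => Disjoint (X i) (X j))
    (hQ : ∀ i j, i ≠ j → ∀ u ∈ X i, ∀ v ∈ X j, (G.Adj u v ↔ Q.Adj i j))
    {ent : J → Finset W → V → Option W} (hent : ∀ j T, IsOptimumOn G H rev (X j) T (ent j T))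
    {S : Finset W} {f : J → Option (Fin K)}
    (hf : IsOptimum Q ((setGraph H).comap e.symm)
      (fun j T => revenue rev (ent j (e.symm T ∩ S))) f)
    {φ : V → Option W}
    (hφ : ∀ j, ∀ v ∈ X j, φ v = ent j ((f j).elim ∅ (fun T => e.symm T) ∩ S) v)
    (hφ' : ∀ v, (∀ j, v ∉ X j) → φ v = none) :
    IsOptimumOn G H rev (⋃ j, X j) S φ ∧
      revenue rev φ = ∑ j, revenue rev (ent j ((f j).elim ∅ (fun T => e.symm T) ∩ S)) := by
  classical
  set σ : J → Finset W := fun j => (f j).elim ∅ (fun T => e.symm T) ∩ S with hσ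
  have hmem : ∀ v, φ v ≠ none → ∃ j, v ∈ X j := fun v hv => by
    by_contra! h
    exact hv (hφ' v h)
  have hsum : revenue rev φ = ∑ j, revenue rev (ent j (σ j)) := by
    rw [revenue_eq_sum_restrict hX hφ']
    refine Finset.sum_congr rfl fun j _ => congrArg _ (funext fun v => ?_)
    by_cases hv : v ∈ X j
    · simp [restrict, hv, hφ j v hv, hσ]
    · rw [(hent j (σ j)).1.eq_none hv]
      simp [restrict, hv]
  refine ⟨⟨⟨?_, ?_⟩, ?_⟩, hsum⟩
  · intro u v huv a b ha hb
    obtain ⟨i, hi⟩ := hmem u (by simp [ha])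
    obtain ⟨j, hj⟩ := hmem v (by simp [hb])
    rw [hφ i u hi] at ha
    rw [hφ j v hj] at hb
    by_cases hij : i = j
    · subst hij
      exact (hent i _).1.1 u v huv a b ha hb
    · have ha' := ((hent i _).1.2 u a ha).2
      have hb' := ((hent j _).1.2 v b hb).2
      have hadj := (hQ i j hij u hi v hj).1 huv
      have hf' := hf.1 i j hadj
      cases hfi : f i with
      | none => simp [hfi] at ha'
      | some T =>
        cases hfj : f j with
        | none => simp [hfj] at hb'
        | some T' =>
          simp only [hfi, hfj, Option.elim_some, Finset.mem_inter] at ha' hb'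
          exact (hf' T T' hfi hfj).2 a ha'.1 b hb'.1
  · intro v a ha
    obtain ⟨j, hj⟩ := hmem v (by simp [ha])
    rw [hφ j v hj] at ha
    exact ⟨Set.mem_iUnion.2 ⟨j, hj⟩, Finset.mem_of_mem_inter_right ((hent j _).1.2 v a ha).2⟩
  · intro ψ hψ
    -- The competitor `ψ` is turned into a coloring `g` of the quotient by the sets `τ j` of colors
    -- that it uses on the modules.
    let τ : J → Finset W := fun j => S.filter fun a => ∃ v ∈ X j, ψ v = some a
    have hτS : ∀ j, τ j ∩ S = τ j := fun j =>
      Finset.inter_eq_left.2 (Finset.filter_subset _ _)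
    have hψτ : ∀ j, IsColoringOn G H (X j) (τ j) (restrict ψ (X j)) := by
      refine fun j => ⟨fun u v huv a b ha hb => ?_, fun v a ha => ?_⟩
      · exact hψ.1 u v huv a b (restrict_eq_some.1 ha).2 (restrict_eq_some.1 hb).2
      · obtain ⟨h1, h2⟩ := restrict_eq_some.1 ha
        exact ⟨h1, Finset.mem_filter.2 ⟨(hψ.2 v a h2).2, v, h1, h2⟩⟩
    -- Modules with empty color set must stay uncolored: two adjacent ones could not both carry `∅`,
    -- as `setGraph H` has no loops.
    let g : J → Option (Fin K) := fun j => if τ j = ∅ then none else some (e (τ j))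
    have hg : IsPartialColoring Q ((setGraph H).comap e.symm) g := by
      intro i j hij T T' hT hT'
      simp only [g, Option.ite_none_left_eq_some, Option.some.injEq] at hT hT'
      obtain ⟨hi, rfl⟩ := hT
      obtain ⟨hj, rfl⟩ := hT'
      have hne : ∀ a ∈ τ i, ∀ b ∈ τ j, H.Adj a b := by
        intro a ha b hb
        obtain ⟨-, u, hu, hua⟩ := Finset.mem_filter.1 ha
        obtain ⟨-, v, hv, hvb⟩ := Finset.mem_filter.1 hb
        exact hψ.1 u v ((hQ i j hij.ne u hu v hv).2 hij) a b hua hvb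
      -- If the two sets coincided, an element of them would be adjacent to itself in `H`.
      obtain ⟨a, ha⟩ := Finset.nonempty_iff_ne_empty.2 hi
      refine ⟨fun h => ?_, by simpa using hne⟩
      simp only [Equiv.symm_apply_apply] at h
      exact (hne a ha a (h ▸ ha)).ne rfl
    calc revenue rev ψ = ∑ j, revenue rev (restrict ψ (X j)) :=
          revenue_eq_sum_restrict hX fun v hv => hψ.eq_none (by simpa using hv)
      _ ≤ ∑ j, (g j).elim 0 fun T => revenue rev (ent j (e.symm T ∩ S)) := by
          refine Finset.sum_le_sum fun j _ => ?_
          by_cases hj : τ j = ∅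
          · have h0 := hψτ j
            rw [hj] at h0
            simp [g, hj, revenue_eq_zero h0.eq_none_of_empty]
          · simp only [g, hj, if_false, Option.elim_some, Equiv.symm_apply_apply, hτS]
            exact (hent j _).2 _ (hψτ j)
      _ ≤ ∑ j, (f j).elim 0 fun T => revenue rev (ent j (e.symm T ∩ S)) := hf.2 g hg
      _ = ∑ j, revenue rev (ent j (σ j)) := by
          refine Finset.sum_congr rfl fun j _ => ?_
          cases hfj : f j with
          | none =>
            have h0 := (hent j (σ j)).1
            rw [show σ j = ∅ by simp [hσ, hfj]] at h0 ⊢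
            simp [revenue_eq_zero h0.eq_none_of_empty]
          | some T => simp [hσ, hfj]
      _ = revenue rev φ := hsum.symm

end Merge

/-! ## Contraction of a smallest module -/

/-- A value together with the list of the colors of a partial coloring of that revenue. -/
abbrev Entry := ℝ × List (Option ℕ)

/-- The vertices that are left, and for every vertex a list of entries. -/
abbrev State := List ℕ × List (List Entry)

/-- A function that selects a solution for every instance. -/
abbrev Solver (K : ℕ) :=
  ∀ m, SimpleGraph (Fin m) → (Fin m → Fin K → ℝ) → Fin m → Option (Fin K)

/-- The list of the colors of a partial coloring. -/
def colorList {n k : ℕ} (φ : Fin n → Option (Fin k)) : List (Option ℕ) :=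
  List.ofFn fun u => (φ u).map Fin.val

/-- The union of the partial colorings of `n` vertices in a list of entries. -/
noncomputable def mergeEntries (n : ℕ) (E : List Entry) : Entry :=
  (E.foldl (fun s e => s + e.1) 0,
    (List.range n).map fun v =>
      E.foldl (fun (acc : Option ℕ) e => acc.elim (e.2.getD v none) some) none)

/-- The values of the entries for the vertices in `B`. -/
def entryRev {K : ℕ} (inter : ℕ → ℕ → ℕ) (tbl : List (List Entry)) (B : List ℕ) (S : ℕ) :
    Fin B.length → Fin K → ℝ :=
  fun j T => (lookup tbl (0, []) B[j] (inter T S)).1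

/-- The combination of the entries for the vertices in `B` that a solution for the graph induced
on `B` prescribes. -/
noncomputable def moduleEntry {K : ℕ} (solve : Solver K) (inter : ℕ → ℕ → ℕ) (emp n : ℕ)
    (G : SimpleGraph ℕ) (tbl : List (List Entry)) (B : List ℕ) (S : ℕ) : Entry :=
  mergeEntries n ((List.range B.length).map fun j => lookup tbl (0, []) (B.getD j 0)
    (((colorList (solve B.length (subG G B) (entryRev inter tbl B S))).getD j none).elim emp
      fun T => inter T S))

/-- Contract a smallest module to its first vertex. -/
noncomputable def contract {K : ℕ} (solve : Solver K) (inter : ℕ → ℕ → ℕ) (emp n : ℕ)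
    (A : List (List Bool)) (G : SimpleGraph ℕ) (s : State) : State :=
  (s.1.filter fun w => !(minModule A s.1).any (fun b => decide (b = w)) ||
      decide (w = (minModule A s.1).headD 0),
    (List.range n).map fun u => if decide (u = (minModule A s.1).headD 0) then
      (List.range K).map fun S => moduleEntry solve inter emp n G s.2 (minModule A s.1) S
      else s.2.getD u [])

open Classical in
/-- The best coloring of the vertex `u` with a color from the set number `S`. -/
noncomputable def vertexEntry (memb : ℕ → ℕ → Bool) (k n : ℕ) (R : List (List ℝ)) (u S : ℕ) :
    Entry :=
  (List.range k).foldl (fun acc a => if memb S a && decide (acc.1 ≤ lookup R 0 u a) then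
    (lookup R 0 u a, (List.range n).map fun v => if decide (v = u) then some a else none) else acc)
    (0, (List.range n).map fun _ => none)

/-- The state before the first contraction. -/
noncomputable def initState (memb : ℕ → ℕ → Bool) (k K n : ℕ) (R : List (List ℝ)) : State :=
  (List.range n, (List.range n).map fun u => (List.range K).map fun S =>
    vertexEntry memb k n R u S)

/-- The state after `n` contractions. -/
noncomputable def finalState {K : ℕ} (solve : Solver K) (inter : ℕ → ℕ → ℕ)
    (memb : ℕ → ℕ → Bool) (emp k n : ℕ) (A : List (List Bool)) (R : List (List ℝ))
    (G : SimpleGraph ℕ) : State :=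
  (List.range n).foldl (fun s _ => contract solve inter emp n A G s) (initState memb k K n R)

/-! ### Running time -/

instance : Enc Data := ⟨id⟩

theorem enc_colorList {n k : ℕ} (φ : Fin n → Option (Fin k)) :
    enc (colorList φ) = encodeColoring φ := by
  change Data.ofList _ = Data.ofList _
  rw [colorList, List.map_ofFn]
  congr 2
  funext u
  change enc ((φ u).map Fin.val) = _
  cases φ u <;> rfl

/-- Fixing one output per instance makes the assumed algorithm a function, to which the `PolyTime`
rules apply; its values outside `C` are irrelevant. -/
theorem SolvableInPolyTime.exists_solver {K : ℕ} {H : SimpleGraph (Fin K)}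
    {C : ∀ n : ℕ, SimpleGraph (Fin n) → Prop} (h : SolvableInPolyTime H C) :
    ∃ solve : Solver K, (∀ m G rev, C m G → IsOptimum G H rev (solve m G rev)) ∧
      PolyTime (ι := {x : Σ m, SimpleGraph (Fin m) × (Fin m → Fin K → ℝ) // C x.1 x.2.1})
        (fun x => x.1.1) (fun x => encodeInstance x.1.2.1 x.1.2.2)
        fun x => colorList (solve x.1.1 x.1.2.1 x.1.2.2) := by
  classical
  obtain ⟨p, P, h⟩ := h
  choose f t hf using h
  refine ⟨fun m G rev => if hC : C m G then f m G hC rev else fun _ => none,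
    fun m G rev hC => ?_, p, P, fun ⟨⟨m, G, rev⟩, hC⟩ => ⟨t m G hC rev, ?_, (hf m G hC rev).2.2⟩⟩
  · simpa [hC] using (hf m G hC rev).2.1
  · rw [enc_colorList]
    have hC' : C m G := hC
    change Run p (encodeInstance G rev) _ _
    simpa [hC'] using (hf m G hC rev).1

namespace PolyTime

variable {ι γ α : Type} [Enc γ] [Enc α] {sz : ι → ℕ} {c : ι → γ}

theorem mono_size {sz' : ι → ℕ} {e : ι → α} (h : PolyTime sz c e) (hs : ∀ i, sz i ≤ sz' i) :
    PolyTime sz' c e := by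
  obtain ⟨p, P, h⟩ := h
  refine ⟨p, P, fun i => ?_⟩
  obtain ⟨t, ht, ht'⟩ := h i
  exact ⟨t, ht, ht'.trans (eval_mono P (hs i))⟩

/-- A function with a bounded argument is given by a finite table. -/
theorem nat_fun {f : ℕ → α} (hc : ∀ a : α, PolyTime sz c fun _ => a) {m : ι → ℕ}
    (hm : PolyTime sz c m) (C : ℕ) (h : ∀ i, m i ≤ C) : PolyTime sz c fun i => f (m i) :=
  ((list_const hc ((List.range (C + 1)).map f)).getD hm (hc (f 0)) (.of_le_const C h)).congr
    fun i => by simp [List.getD_eq_getElem?_getD, Nat.lt_succ_of_le (h i)]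

theorem nat_fun₂ {f : ℕ → ℕ → α} (hc : ∀ a : α, PolyTime sz c fun _ => a) {l m : ι → ℕ}
    (hl : PolyTime sz c l) (hm : PolyTime sz c m) (C : ℕ) (h : ∀ i, l i ≤ C) (h' : ∀ i, m i ≤ C) :
    PolyTime sz c fun i => f (l i) (m i) :=
  ((nat_fun (f := fun a => (List.range (C + 1)).map (f a)) (list_const hc) hl C h).getD hm
    (hc (f 0 0)) (.of_le_const C h')).congr
    fun i => by simp [List.getD_eq_getElem?_getD, Nat.lt_succ_of_le (h' i)]

theorem mergeEntries {n : ι → ℕ} {E : ι → List Entry} (hn : PolyTime sz c n)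
    (hbn : PolyBdd sz n) (hE : PolyTime sz c E) (hlE : PolyBdd sz fun i => (E i).length) :
    PolyTime sz c fun i => mergeEntries (n i) (E i) := by
  refine .prod (foldl' hlE hE real_zero (var.fst.real_add var.snd.fst)) ?_
  refine map (by simpa using hbn) (hn.range hbn) ?_
  refine foldl' (hlE.reindex _) hE.wk none ?_
  refine option_elim var.fst (var.snd.snd.getD var₁ none ?_) var.some
  obtain ⟨P, hP⟩ := hbn
  exact ⟨P, fun x => (List.mem_range.1 x.1.1.2).le.trans (hP _)⟩

variable {K : ℕ} {C : ∀ n : ℕ, SimpleGraph (Fin n) → Prop} {solve : Solver K}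
  {inter : ℕ → ℕ → ℕ} {n : ι → ℕ} {A : ι → List (List Bool)} {G : ι → SimpleGraph ℕ}
  {tbl : ι → List (List Entry)} {B : ι → List ℕ} {S : ι → ℕ}

theorem entry {u T : ι → ℕ} (ht : PolyTime sz c tbl) (hu : PolyTime sz c u)
    (hbu : PolyBdd sz u) (hT : PolyTime sz c T) (hbT : PolyBdd sz T) :
    PolyTime sz c fun i => MaxPartial.lookup (tbl i) (0, []) (u i) (T i) :=
  ht.lookup (real_zero.prod nil) hu hT hbu hbT

/-- The tables written down for the module have exactly the encoding of an instance on `Fin (B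
i).length`, so the assumed program runs on them unchanged; its bound in `(B i).length` is at most
the same bound in `sz i`. -/
theorem solve_module
    (hsolve : PolyTime
      (ι := {x : Σ m, SimpleGraph (Fin m) × (Fin m → Fin K → ℝ) // C x.1 x.2.1})
      (fun x => x.1.1) (fun x => encodeInstance x.1.2.1 x.1.2.2)
      fun x => colorList (solve x.1.1 x.1.2.1 x.1.2.2))
    (hinter : ∀ S T, inter S T ≤ K) (hA : PolyTime sz c A) (ht : PolyTime sz c tbl)
    (hB : PolyTime sz c B) (hS : PolyTime sz c S) (hbB : ∀ i, ∀ u ∈ B i, u ≤ sz i)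
    (hlB : ∀ i, (B i).length ≤ sz i) (hbS : ∀ i, S i ≤ K)
    (hG : ∀ i, ∀ u ∈ B i, ∀ v ∈ B i, MaxPartial.lookup (A i) false u v = true ↔ (G i).Adj u v)
    (hC : ∀ i, C (B i).length (subG (G i) (B i))) :
    PolyTime sz c fun i => colorList
      (solve (B i).length (subG (G i) (B i)) (entryRev inter (tbl i) (B i) (S i))) := by
  classical
  have h1 : PolyTime sz c fun i => (B i).map fun u => (B i).map fun v =>
      MaxPartial.lookup (A i) false u v := by
    refine map (.of_le hlB) hB (map (.of_le fun x => hlB _) hB.wk ?_)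
    exact hA.wk.wk.lookup (bool false) var₁ var (.of_le fun x => hbB _ _ x.1.1.2)
      (.of_le fun x => hbB _ _ x.2)
  have h2 : PolyTime sz c fun i => (B i).map fun u => (List.range K).map fun T =>
      (MaxPartial.lookup (tbl i) (0, []) u (inter T (S i))).1 := by
    refine map (.of_le hlB) hB (map (.of_le_const K fun x => by simp)
      (list_const nat _) (fst ?_))
    exact entry ht.wk.wk var₁ (.of_le fun x => hbB _ _ x.1.1.2)
      (nat_fun₂ nat var hS.wk.wk K (fun x => (List.mem_range.1 x.2).le) fun x => hbS _)
      (.of_le_const K fun x => hinter _ _)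
  have h3 : PolyTime sz c fun i =>
      (encodeInstance (subG (G i) (B i))
        (entryRev (K := K) inter (tbl i) (B i) (S i)) : Data) := by
    refine (h1.prod h2).of_enc_eq fun i => ?_
    refine congrArg₂ Data.pair (congrArg Data.ofList (List.ext_getElem (by simp) ?_))
      (congrArg Data.ofList (List.ext_getElem (by simp) ?_))
    · intro a ha ha'
      simp only [List.getElem_ofFn, List.getElem_map]
      refine congrArg Data.ofList (List.ext_getElem (by simp) ?_)
      intro b hb hb'
      simp only [List.getElem_ofFn, List.getElem_map]
      change Data.ofBool _ = Data.ofBool _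
      congr 1
      rw [Bool.eq_iff_iff, hG i _ (List.getElem_mem _) _ (List.getElem_mem _)]
      simp [subG]
    · intro a ha ha'
      simp only [List.getElem_ofFn, List.getElem_map]
      refine congrArg Data.ofList (List.ext_getElem (by simp) ?_)
      intro b hb hb'
      simp only [List.getElem_ofFn, List.getElem_map, List.getElem_range]
      rfl
  exact h3.comp ((hsolve.reindex fun i => ⟨⟨(B i).length, subG (G i) (B i),
    entryRev inter (tbl i) (B i) (S i)⟩, hC i⟩).mono_size hlB)

theorem moduleEntry {emp : ℕ}
    (hsolve : PolyTime
      (ι := {x : Σ m, SimpleGraph (Fin m) × (Fin m → Fin K → ℝ) // C x.1 x.2.1})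
      (fun x => x.1.1) (fun x => encodeInstance x.1.2.1 x.1.2.2)
      fun x => colorList (solve x.1.1 x.1.2.1 x.1.2.2))
    (hinter : ∀ S T, inter S T ≤ K) (hemp : emp ≤ K) (hA : PolyTime sz c A)
    (ht : PolyTime sz c tbl) (hn : PolyTime sz c n) (hbn : ∀ i, n i ≤ sz i)
    (hB : PolyTime sz c B) (hS : PolyTime sz c S) (hbB : ∀ i, ∀ u ∈ B i, u ≤ sz i)
    (hlB : ∀ i, (B i).length ≤ sz i) (hbS : ∀ i, S i ≤ K)
    (hG : ∀ i, ∀ u ∈ B i, ∀ v ∈ B i, MaxPartial.lookup (A i) false u v = true ↔ (G i).Adj u v)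
    (hC : ∀ i, C (B i).length (subG (G i) (B i))) :
    PolyTime sz c fun i => moduleEntry solve inter emp (n i) (G i) (tbl i) (B i) (S i) := by
  have hout := solve_module hsolve hinter hA ht hB hS hbB hlB hbS hG hC
  refine mergeEntries hn (.of_le hbn) ?_ (.of_le fun i => by simpa using hlB i)
  refine map (.of_le fun i => by simpa using hlB i) ((hB.length (.of_le hlB)).range (.of_le hlB)) ?_
  have hj : PolyBdd (fun x : {x : ι × ℕ // x.2 ∈ List.range (B x.1).length} => sz x.1.1)
      fun x => x.1.2 := .of_le fun x => (List.mem_range.1 x.2).le.trans (hlB _)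
  refine entry ht.wk (hB.wk.getD var (nat 0) hj) (.of_le fun x => ?_) ?_ ?_
  · have hx := List.mem_range.1 x.2
    rw [List.getD_eq_getElem _ _ hx]
    exact hbB _ _ (List.getElem_mem _)
  · refine option_elim (hout.wk.getD var none hj) (nat emp)
      (nat_fun₂ nat var hS.wk.wk K (fun x => ?_) fun x => hbS _)
    have hx := x.2
    have hx' := List.mem_range.1 x.1.1.2
    rw [List.getD_eq_getElem _ _ (by simpa [colorList] using hx')] at hx
    simp only [colorList, List.getElem_ofFn, Option.map_eq_some_iff] at hx
    obtain ⟨T, -, hT⟩ := hx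
    rw [← hT]
    exact T.2.le
  · refine .of_le_const K fun x => ?_
    generalize (colorList _).getD _ _ = o
    cases o
    · exact hemp
    · exact hinter _ _

theorem headD_zero_le {B : List ℕ} {N : ℕ} (h : ∀ u ∈ B, u ≤ N) : B.headD 0 ≤ N := by
  cases B with
  | nil => exact Nat.zero_le N
  | cons u B => exact h u (by simp)

theorem contract {s : ι → State} {emp : ℕ}
    (hsolve : PolyTime
      (ι := {x : Σ m, SimpleGraph (Fin m) × (Fin m → Fin K → ℝ) // C x.1 x.2.1})
      (fun x => x.1.1) (fun x => encodeInstance x.1.2.1 x.1.2.2)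
      fun x => colorList (solve x.1.1 x.1.2.1 x.1.2.2))
    (hinter : ∀ S T, inter S T ≤ K) (hemp : emp ≤ K) (hA : PolyTime sz c A)
    (hn : PolyTime sz c n) (hbn : ∀ i, n i ≤ sz i) (hs : PolyTime sz c s)
    (hbs : ∀ i, ∀ u ∈ (s i).1, u ≤ sz i) (hls : ∀ i, (s i).1.length ≤ sz i)
    (hG : ∀ i, ∀ u ∈ (s i).1, ∀ v ∈ (s i).1,
      MaxPartial.lookup (A i) false u v = true ↔ (G i).Adj u v)
    (hC : ∀ i, C _ (subG (G i) (MaxPartial.minModule (A i) (s i).1))) :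
    PolyTime sz c fun i => contract solve inter emp (n i) (A i) (G i) (s i) := by
  have hB := minModule hA hs.fst hbs hls
  have hsub := fun i => minModule_sublist (A i) (s i).1
  have hbB : ∀ i, ∀ u ∈ MaxPartial.minModule (A i) (s i).1, u ≤ sz i :=
    fun i u hu => hbs i u ((hsub i).subset hu)
  have hlB : ∀ i, (MaxPartial.minModule (A i) (s i).1).length ≤ sz i :=
    fun i => (hsub i).length_le.trans (hls i)
  have hh := hB.headD (nat 0)
  have hbh : PolyBdd sz fun i => (MaxPartial.minModule (A i) (s i).1).headD 0 :=
    .of_le fun i => headD_zero_le (hbB i)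
  refine .prod (filter (.of_le hls) hs.fst (.or (.not ?_) ?_)) ?_
  · exact any (.of_le fun x => hlB _) hB.wk
      (nat_eq var var₁ (.of_le fun x => hbB _ _ x.2) (.of_le fun x => hbs _ _ x.1.1.2))
  · exact nat_eq var hh.wk (.of_le fun x => hbs _ _ x.2) (hbh.reindex _)
  · refine map (.of_le fun i => by simpa using hbn i) (hn.range (.of_le hbn)) ?_
    have hu : PolyBdd (fun x : {x : ι × ℕ // x.2 ∈ List.range (n x.1)} => sz x.1.1)
      fun x => x.1.2 := .of_le fun x => (List.mem_range.1 x.2).le.trans (hbn _)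
    refine .ite (nat_eq var hh.wk hu (hbh.reindex _)) ?_ (hs.snd.wk.getD var nil hu)
    refine map (.of_le_const K fun x => by simp) (list_const nat _) ?_
    exact moduleEntry hsolve hinter hemp hA.wk.wk hs.snd.wk.wk hn.wk.wk (fun x => hbn _) hB.wk.wk
      var (fun x => hbB _) (fun x => hlB _) (fun x => (List.mem_range.1 x.2).le)
      (fun x u hu v hv => hG _ u ((hsub _).subset hu) v ((hsub _).subset hv)) fun x => hC _

variable {memb : ℕ → ℕ → Bool} {k : ℕ} {R : ι → List (List ℝ)}

theorem vertexEntry {u : ι → ℕ} (hn : PolyTime sz c n) (hbn : ∀ i, n i ≤ sz i)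
    (hR : PolyTime sz c R) (hu : PolyTime sz c u) (hbu : PolyBdd sz u) (hS : PolyTime sz c S)
    (hbS : ∀ i, S i ≤ K) :
    PolyTime sz c fun i => vertexEntry memb k (n i) (R i) (u i) (S i) := by
  have hr := hn.range (.of_le hbn)
  have hlr : PolyBdd sz fun i => (List.range (n i)).length := .of_le fun i => by simpa using hbn i
  refine foldl' (.of_le_const k fun i => by simp) (list_const nat _)
    (real_zero.prod (map hlr hr none)) ?_
  have ha : ∀ x : {x : ι × Entry × ℕ // True ∧ x.2.2 ∈ List.range k}, x.1.2.2 ≤ k :=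
    fun x => (List.mem_range.1 x.2.2).le
  have hl := hR.wk.lookup real_zero hu.wk var.snd (hbu.reindex _) (.of_le_const k ha)
  refine .ite (.and ?_ (real_le var.fst.fst hl)) (hl.prod ?_) var.fst
  · exact nat_fun₂ bool hS.wk var.snd (max K k) (fun x => (hbS _).trans (le_max_left _ _))
      fun x => (ha x).trans (le_max_right _ _)
  · refine map (hlr.reindex _) hr.wk (.ite (nat_eq var hu.wk.wk ?_ (hbu.reindex _)) ?_ none)
    · exact .of_le fun x => (List.mem_range.1 x.2).le.trans (hbn _)
    · exact var₁.snd.some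

theorem initState (hn : PolyTime sz c n) (hbn : ∀ i, n i ≤ sz i) (hR : PolyTime sz c R) :
    PolyTime sz c fun i => initState memb k K (n i) (R i) := by
  have hr := hn.range (.of_le hbn)
  have hlr : PolyBdd sz fun i => (List.range (n i)).length := .of_le fun i => by simpa using hbn i
  refine hr.prod (map hlr hr (map (.of_le_const K fun x => by simp) (list_const nat _) ?_))
  exact vertexEntry hn.wk.wk (fun x => hbn _) hR.wk.wk var₁
    (.of_le fun x => (List.mem_range.1 x.1.1.2).le.trans (hbn _)) var
    fun x => (List.mem_range.1 x.2).le

end PolyTime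

theorem contract_sublist {K : ℕ} (solve : Solver K) (inter : ℕ → ℕ → ℕ) (emp n : ℕ)
    (A : List (List Bool)) (G : SimpleGraph ℕ) (s : State) :
    (contract solve inter emp n A G s).1.Sublist s.1 := List.filter_sublist

theorem foldl_contract_sublist {K : ℕ} (solve : Solver K) (inter : ℕ → ℕ → ℕ) (emp n : ℕ)
    (A : List (List Bool)) (G : SimpleGraph ℕ) (l : List ℕ) {s : State} {R : List ℕ}
    (h : s.1.Sublist R) :
    (l.foldl (fun s _ => contract solve inter emp n A G s) s).1.Sublist R :=
  foldl_invariant (p := fun s : State => s.1.Sublist R) l h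
    fun s _ _ hs => (contract_sublist solve inter emp n A G s).trans hs

namespace PolyTime

variable {ι γ α : Type} [Enc γ] [Enc α] {sz : ι → ℕ} {c : ι → γ}
  {K : ℕ} {C : ∀ n : ℕ, SimpleGraph (Fin n) → Prop} {solve : Solver K}
  {inter : ℕ → ℕ → ℕ} {n : ι → ℕ} {A : ι → List (List Bool)} {G : ι → SimpleGraph ℕ}
  {memb : ℕ → ℕ → Bool} {emp k : ℕ} {R : ι → List (List ℝ)}

/-- The invariant is only that the remaining vertices form a sublist of `List.range (n i)`. This
bounds all lists and, by `hC`, keeps every call of the solver within its class; correctness of the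
entries plays no role. -/
theorem finalState
    (hsolve : PolyTime
      (ι := {x : Σ m, SimpleGraph (Fin m) × (Fin m → Fin K → ℝ) // C x.1 x.2.1})
      (fun x => x.1.1) (fun x => encodeInstance x.1.2.1 x.1.2.2)
      fun x => colorList (solve x.1.1 x.1.2.1 x.1.2.2))
    (hinter : ∀ S T, inter S T ≤ K) (hemp : emp ≤ K) (hA : PolyTime sz c A)
    (hn : PolyTime sz c n) (hbn : ∀ i, n i ≤ sz i) (hR : PolyTime sz c R)
    (hG : ∀ i, ∀ u < n i, ∀ v < n i,
      MaxPartial.lookup (A i) false u v = true ↔ (G i).Adj u v)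
    (hC : ∀ i, ∀ L : List ℕ, L.Sublist (List.range (n i)) →
      C _ (subG (G i) (MaxPartial.minModule (A i) L))) :
    PolyTime sz c fun i => finalState solve inter memb emp k (n i) (A i) (R i) (G i) := by
  have hr := hn.range (.of_le hbn)
  have hlr : PolyBdd sz fun i => (List.range (n i)).length := .of_le fun i => by simpa using hbn i
  refine foldl (fun i s => s.1.Sublist (List.range (n i))) (fun i => .refl _)
    (fun i s _ hs _ => (contract_sublist _ _ _ _ _ _ s).trans hs) hlr hr (initState hn hbn hR) ?_
  have hlt : ∀ x : {x : ι × State × ℕ //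
      x.2.1.1.Sublist (List.range (n x.1)) ∧ x.2.2 ∈ List.range (n x.1)},
      ∀ u ∈ x.1.2.1.1, u < n x.1.1 := fun x u hu => List.mem_range.1 (x.2.1.subset hu)
  exact contract hsolve hinter hemp hA.wk hn.wk (fun x => hbn _) var.fst
    (fun x u hu => (hlt x u hu).le.trans (hbn _))
    (fun x => x.2.1.length_le.trans (by simpa using hbn _))
    (fun x u hu v hv => hG _ u (hlt x u hu) v (hlt x v hv)) fun x => hC _ _ x.2.1

end PolyTime

/-! ## Correctness of the contractions -/

theorem foldl_elim_eq_findSome? {α β : Type*} (f : α → Option β) (l : List α) :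
    l.foldl (fun (acc : Option β) x => acc.elim (f x) some) none = l.findSome? f := by
  have h : ∀ (l : List α) (b : β),
      l.foldl (fun (acc : Option β) x => acc.elim (f x) some) (some b) = some b := by
    intro l b
    induction l with
    | nil => rfl
    | cons x l ih => exact ih
  induction l with
  | nil => rfl
  | cons x l ih =>
    rw [List.foldl_cons, List.findSome?_cons, Option.elim_none]
    cases f x with
    | none => exact ih
    | some b => exact h l b

/-- Evaluates a union of colorings with disjoint domains: at each vertex at most one of them is
defined. -/
theorem findSome?_eq_of_unique {α β : Type*} {f : α → Option β} {l : List α} {x : α} (hx : x ∈ l)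
    (h : ∀ y ∈ l, y ≠ x → f y = none) : l.findSome? f = f x := by
  induction l with
  | nil => simp at hx
  | cons y l ih =>
    rw [List.findSome?_cons]
    by_cases hxy : y = x
    · subst hxy
      cases hf : f y with
      | some b => rfl
      | none =>
        simp only [List.findSome?_eq_none_iff]
        intro z hz
        by_cases hzy : z = y
        · rw [hzy, hf]
        · exact h z (by simp [hz]) hzy
    · rw [h y (by simp) hxy]
      exact ih ((List.mem_cons.1 hx).resolve_left fun h => hxy h.symm)
        fun z hz => h z (by simp [hz])

theorem getD_map_range {α : Type} {N : ℕ} (f : ℕ → α) (d : α) {u : ℕ} (hu : u < N) :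
    ((List.range N).map f).getD u d = f u := by
  simp [List.getD_eq_getElem?_getD, hu]

theorem lookup_map_range {α : Type} {N M : ℕ} (f : ℕ → ℕ → α) (d : α) {u v : ℕ} (hu : u < N)
    (hv : v < M) :
    lookup ((List.range N).map fun a => (List.range M).map (f a)) d u v = f u v := by
  rw [lookup, getD_map_range _ _ hu, getD_map_range _ _ hv]

theorem lookup_ofFn {α : Type} {N M : ℕ} (f : Fin N → Fin M → α) (d : α) (u : Fin N) (v : Fin M) :
    lookup (List.ofFn fun a => List.ofFn (f a)) d u v = f u v := by
  simp [lookup, List.getD_eq_getElem?_getD]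

theorem colorList_getD {n k : ℕ} (φ : Fin n → Option (Fin k)) (v : Fin n) :
    (colorList φ).getD v none = (φ v).map Fin.val := by
  simp [colorList, List.getD_eq_getElem?_getD]

theorem map_range_eq_colorList {n k : ℕ} {f : ℕ → Option ℕ} {φ : Fin n → Option (Fin k)}
    (h : ∀ v : Fin n, f v = (φ v).map Fin.val) : (List.range n).map f = colorList φ :=
  List.ext_getElem (by simp [colorList]) fun i hi hi' => by
    simpa [colorList] using h ⟨i, by simpa using hi⟩

section Correctness

variable {n k K : ℕ} {G : SimpleGraph (Fin n)} {H : SimpleGraph (Fin k)}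
  {rev : Fin n → Fin k → ℝ} (e : Finset (Fin k) ≃ Fin K)

/-- The intersection of sets of colors in terms of their numbers. -/
def interIdx (S T : ℕ) : ℕ :=
  if h : S < K ∧ T < K then e (e.symm ⟨S, h.1⟩ ∩ e.symm ⟨T, h.2⟩) else 0

/-- Membership of a color in the set of a given number. -/
def membIdx (S a : ℕ) : Bool :=
  if h : S < K ∧ a < k then decide ((⟨a, h.2⟩ : Fin k) ∈ e.symm ⟨S, h.1⟩) else false

theorem interIdx_le (S T : ℕ) : interIdx e S T ≤ K := by
  unfold interIdx
  split
  · exact (Fin.is_lt _).le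
  · exact Nat.zero_le K

theorem interIdx_val (S T : Fin K) : interIdx e S T = e (e.symm S ∩ e.symm T) := by
  simp [interIdx]

/-- The entry is an optimum coloring with domain in `X` and colors in `S`. -/
def EntryOk (G : SimpleGraph (Fin n)) (H : SimpleGraph (Fin k)) (rev : Fin n → Fin k → ℝ)
    (X : Set (Fin n)) (S : Finset (Fin k)) (E : Entry) : Prop :=
  ∃ φ : Fin n → Option (Fin k), E.2 = colorList φ ∧ E.1 = revenue rev φ ∧
    IsOptimumOn G H rev X S φ

variable {e}

theorem vertexEntry_ok {R : List (List ℝ)} (hR : ∀ (u : Fin n) (a : Fin k),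
    lookup R 0 u a = rev u a) (u : Fin n) (S : Fin K) :
    EntryOk G H rev {v | (v : ℕ) = u} (e.symm S) (vertexEntry (membIdx e) k n R u S) := by
  classical
  -- Induction on the number of colors tried. The start value is the empty coloring, whence the
  -- nonnegativity of the revenue.
  have key : ∀ m ≤ k, ∃ φ : Fin n → Option (Fin k),
      (vertexEntry (membIdx e) m n R u S).2 = colorList φ ∧
      (vertexEntry (membIdx e) m n R u S).1 = revenue rev φ ∧
      IsColoringOn G H {v | (v : ℕ) = u} (e.symm S) φ ∧ 0 ≤ revenue rev φ ∧
      ∀ a : Fin k, (a : ℕ) < m → a ∈ e.symm S → rev u a ≤ revenue rev φ := by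
    intro m
    induction m with
    | zero =>
      intro _
      refine ⟨fun _ => none, map_range_eq_colorList fun _ => rfl, ?_, ⟨?_, ?_⟩, ?_, ?_⟩ <;>
        simp [vertexEntry, revenue, IsPartialColoring]
    | succ m ih =>
      intro hm
      obtain ⟨φ, h1, h2, h3, h4, h5⟩ := ih (by omega)
      have hstep : vertexEntry (membIdx e) (m + 1) n R u S =
          if membIdx e S m && decide ((vertexEntry (membIdx e) m n R u S).1 ≤ lookup R 0 u m) then
            (lookup R 0 u m,
              (List.range n).map fun v => if decide (v = (u : ℕ)) then some m else none)
          else vertexEntry (membIdx e) m n R u S := by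
        simp only [vertexEntry]
        rw [List.range_succ, List.foldl_append]
        rfl
      have hmemb : membIdx e S m = true ↔ (⟨m, hm⟩ : Fin k) ∈ e.symm S := by
        simp [membIdx, show m < k from hm]
      have hRm := hR u ⟨m, hm⟩
      dsimp only at hRm
      rw [hstep, hRm, h2]
      by_cases hc : (membIdx e S m && decide (revenue rev φ ≤ rev u ⟨m, hm⟩)) = true
      · rw [if_pos hc]
        simp only [Bool.and_eq_true, decide_eq_true_eq, hmemb] at hc
        have hrev : revenue rev (fun v => if v = u then some (⟨m, hm⟩ : Fin k) else none) =
            rev u ⟨m, hm⟩ := by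
          unfold revenue
          rw [Finset.sum_eq_single u]
          · simp
          · intro v _ hv
            simp [hv]
          · simp
        refine ⟨fun v => if v = u then some ⟨m, hm⟩ else none, ?_, hrev.symm, ⟨?_, ?_⟩, ?_, ?_⟩
        · refine map_range_eq_colorList fun v => ?_
          by_cases hv : v = u <;> simp [hv, Fin.val_inj]
        · intro x y hxy a b ha hb
          simp only [Option.ite_none_right_eq_some] at ha hb
          exact absurd (ha.1.trans hb.1.symm) hxy.ne
        · intro v a ha
          simp only [Option.ite_none_right_eq_some, Option.some.injEq] at ha
          obtain ⟨rfl, rfl⟩ := ha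
          exact ⟨rfl, hc.1⟩
        · rw [hrev]
          exact h4.trans hc.2
        · intro a ha haS
          rw [hrev]
          rcases Nat.lt_succ_iff_lt_or_eq.1 ha with ha | ha
          · exact (h5 a ha haS).trans hc.2
          · rw [show a = ⟨m, hm⟩ from Fin.ext ha]
      · rw [if_neg hc]
        refine ⟨φ, h1, h2, h3, h4, fun a ha haS => ?_⟩
        rcases Nat.lt_succ_iff_lt_or_eq.1 ha with ha | ha
        · exact h5 a ha haS
        · have ha' : a = ⟨m, hm⟩ := Fin.ext ha
          subst ha'
          simp only [Bool.and_eq_true, decide_eq_true_eq, hmemb, not_and] at hc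
          exact (not_le.1 (hc haS)).le
  obtain ⟨φ, h1, h2, h3, h4, h5⟩ := key k le_rfl
  refine ⟨φ, h1, h2, h3, fun ψ hψ => ?_⟩
  have hψ' : revenue rev ψ = (ψ u).elim 0 (rev u) := by
    unfold revenue
    rw [Finset.sum_eq_single u]
    · intro v _ hv
      rw [hψ.eq_none fun h => hv (Fin.ext h)]
      rfl
    · simp
  rw [hψ']
  cases hu : ψ u with
  | none => exact h4
  | some a => exact h5 a a.2 (hψ.2 u a hu).2

theorem mergeEntries_map {m : ℕ} {E : Fin m → Entry} {φ : Fin m → Fin n → Option (Fin k)}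
    (hE : ∀ j, (E j).2 = colorList (φ j)) :
    mergeEntries n ((List.finRange m).map E) = (∑ j, (E j).1,
      colorList fun v => (List.finRange m).findSome? fun j => φ j v) := by
  refine Prod.ext ?_ (map_range_eq_colorList fun v => ?_)
  · simp only [mergeEntries]
    rw [List.foldl_map, ← List.foldl_map (f := fun j => (E j).1) (g := fun s x => s + x),
      ← List.sum_eq_foldl, ← List.ofFn_eq_map, List.sum_ofFn]
  · rw [List.foldl_map, foldl_elim_eq_findSome? (f := fun j => (E j).2.getD v none)]
    simp only [hE, colorList_getD]
    rw [List.map_findSome?]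
    rfl

variable {tbl : List (List Entry)} {blk : Fin n → ℕ} {B : List ℕ}

/-- The default `e ∅` is consistent with the intersection: an uncolored quotient vertex gets the
color set `∅ = ∅ ∩ S`. -/
theorem moduleEntry_eq {solve : Solver K} {Q : SimpleGraph ℕ} {S : Fin K}
    {f : Fin B.length → Option (Fin K)}
    (hf : solve _ (subG Q B) (entryRev (interIdx e) tbl B S) = f) :
    moduleEntry solve (interIdx e) (e ∅) n Q tbl B S =
      mergeEntries n ((List.finRange B.length).map fun j =>
        lookup tbl (0, []) B[j] (e ((f j).elim ∅ (fun T => e.symm T) ∩ e.symm S))) := by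
  rw [moduleEntry, hf]
  congr 1
  refine List.ext_getElem (by simp) fun j hj hj' => ?_
  have hjB : j < B.length := by simpa using hj
  have hc : (colorList f).getD j none = (f ⟨j, hjB⟩).map Fin.val := colorList_getD f ⟨j, hjB⟩
  simp only [List.getElem_map, List.getElem_range, List.getElem_finRange, Fin.cast_mk]
  rw [List.getD_eq_getElem _ _ hjB, hc]
  congr 1
  cases f ⟨j, hjB⟩ with
  | none => simp
  | some T => exact interIdx_val e T S

/-- This is `IsOptimumOn.merge` for the blocks of the vertices in `B`, with the table entries as the
optimum colorings of the blocks. -/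
theorem moduleEntry_ok {solve : Solver K} {Q : SimpleGraph ℕ}
    (hsolve : ∀ r, IsOptimum (subG Q B) ((setGraph H).comap e.symm) r (solve _ (subG Q B) r))
    (hB : B.Nodup) (hblk : ∀ u v, blk u ≠ blk v → (G.Adj u v ↔ Q.Adj (blk u) (blk v)))
    (htbl : ∀ u ∈ B, ∀ S : Fin K,
      EntryOk G H rev {v | blk v = u} (e.symm S) (lookup tbl (0, []) u S)) (S : Fin K) :
    EntryOk G H rev {v | blk v ∈ B} (e.symm S)
      (moduleEntry solve (interIdx e) (e ∅) n Q tbl B S) := by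
  have htbl' : ∀ (j : Fin B.length) (T : Finset (Fin k)),
      EntryOk G H rev {v | blk v = B[j]} T (lookup tbl (0, []) B[j] (e T)) := by
    intro j T
    simpa using htbl B[j] (List.getElem_mem _) (e T)
  choose ent hent1 hent2 hent3 using htbl'
  have hopt := hsolve (entryRev (interIdx e) tbl B S)
  have hrev : (entryRev (interIdx e) tbl B S : Fin B.length → Fin K → ℝ) =
      fun j T => revenue rev (ent j (e.symm T ∩ e.symm S)) := by
    funext j T
    rw [entryRev, interIdx_val]
    exact hent2 j _
  rw [moduleEntry_eq rfl]
  generalize solve _ (subG Q B) (entryRev (interIdx e) tbl B S) = f at hopt ⊢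
  rw [hrev] at hopt
  rw [mergeEntries_map fun j => hent1 j _]
  have hinj : ∀ {i j : Fin B.length}, B[i] = B[j] → i = j := fun h =>
    Fin.ext ((List.Nodup.getElem_inj_iff hB).1 h)
  have hX : {v | blk v ∈ B} = ⋃ j : Fin B.length, {v | blk v = B[j]} := by
    ext v
    simp only [Set.mem_ofPred_eq, Set.mem_iUnion]
    constructor
    · intro h
      obtain ⟨j, hj, h⟩ := List.getElem_of_mem h
      exact ⟨⟨j, hj⟩, h.symm⟩
    · rintro ⟨j, h⟩
      rw [h]
      exact List.getElem_mem _
  have hdisj : Pairwise fun i j : Fin B.length =>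
      Disjoint {v | blk v = B[i]} {v | blk v = B[j]} := fun i j hij =>
    Set.disjoint_left.2 fun v hi hj => hij (hinj (Eq.trans (Eq.symm hi) hj))
  obtain ⟨h1, h2⟩ := IsOptimumOn.merge e (X := fun j : Fin B.length => {v | blk v = B[j]})
    (Q := subG Q B) (S := e.symm S) (f := f) hdisj
    (fun i j hij u hu v hv => by
      rw [Set.mem_ofPred_eq] at hu hv
      rw [hblk u v (by rw [hu, hv]; exact fun h => hij (hinj h)), hu, hv]
      rfl)
    hent3 hopt
    (φ := fun v => (List.finRange B.length).findSome? fun j =>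
      ent j ((f j).elim ∅ (fun T => e.symm T) ∩ e.symm S) v)
    (fun j v hv => findSome?_eq_of_unique (List.mem_finRange j) fun i _ hij =>
      (hent3 i _).1.eq_none fun hi => Set.disjoint_left.1 (hdisj hij) hi hv)
    (fun v hv => List.findSome?_eq_none_iff.2 fun j _ => (hent3 j _).1.eq_none (hv j))
  refine ⟨_, rfl, ?_, hX ▸ h1⟩
  rw [h2]
  dsimp only
  exact Finset.sum_congr rfl fun j _ => hent2 j ((f j).elim ∅ (fun T => e.symm T) ∩ e.symm S)

/-- The vertices are partitioned into modules with representatives `s.1`, and the entries are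
optimum colorings of these modules. -/
structure StateOk (e : Finset (Fin k) ≃ Fin K) (G : SimpleGraph (Fin n)) (H : SimpleGraph (Fin k))
    (rev : Fin n → Fin k → ℝ) (s : State) : Prop where
  sublist : s.1.Sublist (List.range n)
  blocks : ∃ blk : Fin n → ℕ, (∀ v, blk v ∈ s.1) ∧
    (∀ u v, blk u ≠ blk v → (G.Adj u v ↔ (G.map Fin.valEmbedding).Adj (blk u) (blk v))) ∧
    ∀ u ∈ s.1, ∀ S : Fin K,
      EntryOk G H rev {v | blk v = u} (e.symm S) (lookup s.2 (0, []) u S)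

theorem initState_ok {R : List (List ℝ)} (hR : ∀ (u : Fin n) (a : Fin k),
    lookup R 0 u a = rev u a) : StateOk e G H rev (initState (membIdx e) k K n R) := by
  refine ⟨.refl _, Fin.val, fun v => by simp [initState], fun u v _ => ?_, fun u hu S => ?_⟩
  · exact (SimpleGraph.map_adj_apply (f := Fin.valEmbedding)).symm
  · have hu' := List.mem_range.1 hu
    rw [initState, lookup_map_range _ _ hu' S.2]
    exact vertexEntry_ok hR ⟨u, hu'⟩ S

theorem StateOk.ne_nil {s : State} (h : StateOk e G H rev s) (hn : 0 < n) : s.1 ≠ [] := by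
  obtain ⟨blk, h1, -⟩ := h.blocks
  exact List.ne_nil_of_mem (h1 ⟨0, hn⟩)

variable {solve : Solver K} {A : List (List Bool)} {s : State}

theorem headD_minModule_mem {R : List ℕ} (hR : R ≠ []) :
    (minModule A R).headD 0 ∈ minModule A R := by
  have := minModule_ne_nil (A := A) hR
  cases h : minModule A R with
  | nil => exact absurd h this
  | cons b B => simp

theorem mem_contract {inter : ℕ → ℕ → ℕ} {emp : ℕ} {Q : SimpleGraph ℕ} {w : ℕ} :
    w ∈ (contract solve inter emp n A Q s).1 ↔
      w ∈ s.1 ∧ (w ∉ minModule A s.1 ∨ w = (minModule A s.1).headD 0) := by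
  have h : (∀ x ∈ minModule A s.1, ¬ x = w) ↔ w ∉ minModule A s.1 :=
    ⟨fun h hw => h w hw rfl, fun h x hx hxw => h (hxw ▸ hx)⟩
  simp [contract, h]

theorem lookup_contract {inter : ℕ → ℕ → ℕ} {emp : ℕ} {Q : SimpleGraph ℕ} {d : Entry} {u S : ℕ}
    (hu : u < n) (hS : S < K) : lookup (contract solve inter emp n A Q s).2 d u S =
      if u = (minModule A s.1).headD 0 then
        moduleEntry solve inter emp n Q s.2 (minModule A s.1) S
      else lookup s.2 d u S := by
  simp only [contract, lookup]
  rw [getD_map_range _ _ hu]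
  simp only [decide_eq_true_eq]
  split
  · rw [getD_map_range _ _ hS]
  · rfl

/-- All blocks represented in the smallest module are united under its first vertex `b`. A
representative outside sees every element of the module as it sees `b`, so adjacency between blocks
can still be read off the representatives. -/
theorem StateOk.contract (h : StateOk e G H rev s) (hn : 0 < n)
    (hA : ∀ u < n, ∀ v < n, lookup A false u v = true ↔ (G.map Fin.valEmbedding).Adj u v)
    (hsolve : ∀ r, IsOptimum (subG (G.map Fin.valEmbedding) (minModule A s.1))
      ((setGraph H).comap e.symm) r
      (solve _ (subG (G.map Fin.valEmbedding) (minModule A s.1)) r)) :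
    StateOk e G H rev (contract solve (interIdx e) (e ∅) n A (G.map Fin.valEmbedding) s) := by
  classical
  refine ⟨(contract_sublist _ _ _ _ _ _ _).trans h.sublist, ?_⟩
  obtain ⟨blk, hblk, hadj, hent⟩ := h.blocks
  have hnd := h.sublist.nodup List.nodup_range
  have hsub := minModule_sublist A s.1
  have hb := headD_minModule_mem (A := A) (h.ne_nil hn)
  have hmod := minModule_isListModule (A := A) hnd
  have hlt : ∀ u ∈ s.1, u < n := fun u hu => List.mem_range.1 (h.sublist.subset hu)
  set b := (minModule A s.1).headD 0 with hbdef
  have hmod' : ∀ w ∈ s.1, w ∉ minModule A s.1 → ∀ a ∈ minModule A s.1,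
      ((G.map Fin.valEmbedding).Adj w a ↔ (G.map Fin.valEmbedding).Adj w b) := by
    intro w hw hwB a ha
    rw [← hA w (hlt w hw) a (hlt a (hsub.subset ha)), ← hA w (hlt w hw) b (hlt b (hsub.subset hb)),
      hmod w hw hwB a ha b hb]
  refine ⟨fun v => if blk v ∈ minModule A s.1 then b else blk v, fun v => ?_, fun u v huv => ?_,
    fun u hu S => ?_⟩
  · rw [mem_contract]
    beta_reduce
    split
    · exact ⟨hsub.subset hb, .inr rfl⟩
    · exact ⟨hblk v, .inl ‹_›⟩
  · by_cases hu : blk u ∈ minModule A s.1 <;> by_cases hv : blk v ∈ minModule A s.1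
    · simp [hu, hv] at huv
    · have hne : blk u ≠ blk v := fun h => hv (h ▸ hu)
      simp only [hu, hv, if_true, if_false]
      rw [hadj u v hne, SimpleGraph.adj_comm, hmod' _ (hblk v) hv _ hu, SimpleGraph.adj_comm]
    · have hne : blk u ≠ blk v := fun h => hu (h ▸ hv)
      simp only [hu, hv, if_true, if_false]
      rw [hadj u v hne, hmod' _ (hblk u) hu _ hv]
    · simp only [hu, hv, if_false] at huv ⊢
      exact hadj u v huv
  · rw [mem_contract] at hu
    have hun : u < n := hlt u hu.1
    by_cases hub : u = b
    · have hl : lookup (MaxPartial.contract solve (interIdx e) (e ∅) n A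
          (G.map Fin.valEmbedding) s).2 (0, []) u S = moduleEntry solve (interIdx e) (e ∅) n
            (G.map Fin.valEmbedding) s.2 (minModule A s.1) S := by
        rw [lookup_contract hun S.2, if_pos (hub.trans hbdef)]
      have hX : {v | (if blk v ∈ minModule A s.1 then b else blk v) = u} =
          {v | blk v ∈ minModule A s.1} := by
        ext v
        simp only [Set.mem_ofPred_eq]
        split
        · simp [*]
        · exact iff_of_false (fun h => ‹blk v ∉ _› (by rw [h, hub]; exact hb)) ‹_›
      rw [hl, hX]
      exact moduleEntry_ok hsolve (hsub.nodup hnd) hadj (fun u hu => hent u (hsub.subset hu)) S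
    · have huB := hu.2.resolve_right hub
      have hl : lookup (MaxPartial.contract solve (interIdx e) (e ∅) n A
          (G.map Fin.valEmbedding) s).2 (0, []) u S = lookup s.2 (0, []) u S := by
        rw [lookup_contract hun S.2, if_neg hub]
      have hX : {v | (if blk v ∈ minModule A s.1 then b else blk v) = u} = {v | blk v = u} := by
        ext v
        simp only [Set.mem_ofPred_eq]
        split
        · exact iff_of_false (fun h => hub h.symm) fun h => huB (h ▸ ‹_›)
        · rfl
      rw [hl, hX]
      exact hent u hu.1 S

/-- The module has at least two elements, and only its first one survives. -/
theorem contract_length_lt {inter : ℕ → ℕ → ℕ} {emp : ℕ} {Q : SimpleGraph ℕ} (hs : s.1.Nodup)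
    (h2 : 2 ≤ s.1.length) : (contract solve inter emp n A Q s).1.length < s.1.length := by
  have hl := two_le_length_minModule (A := A) h2
  have hsub := minModule_sublist A s.1
  obtain ⟨w, hw, hwb⟩ : ∃ w ∈ minModule A s.1, w ≠ (minModule A s.1).headD 0 := by
    have hnd := hsub.nodup hs
    revert hl hnd
    generalize minModule A s.1 = B
    intro hl hnd
    match B, hl, hnd with
    | a :: b :: B, _, hnd =>
      refine ⟨b, by simp, ?_⟩
      rintro rfl
      simp at hnd
  refine lt_of_le_of_ne (contract_sublist _ _ _ _ _ _ s).length_le fun h => ?_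
  have heq := (contract_sublist solve inter emp n A Q s).eq_of_length h
  have := heq ▸ hsub.subset hw
  rw [mem_contract] at this
  exact this.2.elim (fun h => h hw) hwb

theorem finalState_ok {R : List (List ℝ)}
    (hR : ∀ (u : Fin n) (a : Fin k), lookup R 0 u a = rev u a)
    (hA : ∀ u < n, ∀ v < n, lookup A false u v = true ↔ (G.map Fin.valEmbedding).Adj u v)
    (hsolve : ∀ L : List ℕ, L.Sublist (List.range n) → ∀ r,
      IsOptimum (subG (G.map Fin.valEmbedding) (minModule A L)) ((setGraph H).comap e.symm) r
        (solve _ (subG (G.map Fin.valEmbedding) (minModule A L)) r)) :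
    StateOk e G H rev (finalState solve (interIdx e) (membIdx e) (e ∅) k n A R
      (G.map Fin.valEmbedding)) ∧
    (finalState solve (interIdx e) (membIdx e) (e ∅) k n A R
      (G.map Fin.valEmbedding)).1.length ≤ 1 := by
  -- The maximum with `1` covers rounds in which a single representative is left; such a contraction
  -- still preserves `StateOk`.
  have key : ∀ m ≤ n, StateOk e G H rev ((List.range m).foldl (fun s _ =>
        contract solve (interIdx e) (e ∅) n A (G.map Fin.valEmbedding) s)
        (initState (membIdx e) k K n R)) ∧
      ((List.range m).foldl (fun s _ =>
        contract solve (interIdx e) (e ∅) n A (G.map Fin.valEmbedding) s)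
        (initState (membIdx e) k K n R)).1.length ≤ max 1 (n - m) := by
    intro m
    induction m with
    | zero => exact fun _ => ⟨initState_ok hR, by simp [initState]⟩
    | succ m ih =>
      intro hm
      obtain ⟨h1, h2⟩ := ih (by omega)
      rw [List.range_succ, List.foldl_append]
      simp only [List.foldl_cons, List.foldl_nil]
      revert h1 h2
      generalize (List.range m).foldl (fun s _ =>
        contract solve (interIdx e) (e ∅) n A (G.map Fin.valEmbedding) s)
        (initState (membIdx e) k K n R) = s
      intro h1 h2
      refine ⟨h1.contract (by omega) hA (hsolve _ h1.sublist), ?_⟩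
      by_cases hl : 2 ≤ s.1.length
      · have := contract_length_lt (solve := solve) (inter := interIdx e) (emp := e ∅) (n := n)
          (A := A) (Q := G.map Fin.valEmbedding) (h1.sublist.nodup List.nodup_range) hl
        omega
      · have := (contract_sublist solve (interIdx e) (e ∅) n A
          (G.map Fin.valEmbedding) s).length_le
        omega
  exact ⟨(key n le_rfl).1, (key n le_rfl).2.trans (by simp)⟩

theorem StateOk.isOptimum (h : StateOk e G H rev s) (hn : 0 < n) (hl : s.1.length ≤ 1) :
    ∃ φ, (lookup s.2 (0, []) (s.1.headD 0) (e Finset.univ)).2 = colorList φ ∧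
      IsOptimum G H rev φ := by
  obtain ⟨blk, hblk, -, hent⟩ := h.blocks
  obtain ⟨u, hu⟩ := List.length_eq_one_iff.1
    (le_antisymm hl (List.length_pos_iff.2 (h.ne_nil hn)))
  simp only [hu, List.mem_singleton] at hblk hent ⊢
  obtain ⟨φ, h1, -, h2, h3⟩ := hent u rfl (e Finset.univ)
  -- With a single block and all colors allowed, every partial coloring is a competitor.
  exact ⟨φ, h1, h2.1, fun ψ hψ => h3 ψ ⟨hψ, fun v a _ => ⟨hblk v, by simp⟩⟩⟩

end Correctness

/-! ## The reduction to prime graphs -/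

theorem subG_isIndContained {n : ℕ} {G : SimpleGraph (Fin n)} {B : List ℕ} (hB : B.Nodup)
    (hlt : ∀ u ∈ B, u < n) : (subG (G.map Fin.valEmbedding) B).IsIndContained G :=
  ⟨{ toFun := fun j => ⟨B[j], hlt _ (List.getElem_mem _)⟩
     inj' := fun _ _ h => Fin.ext ((List.Nodup.getElem_inj_iff hB).1 (Fin.ext_iff.1 h))
     map_rel_iff' := (SimpleGraph.map_adj_apply (f := Fin.valEmbedding)).symm }⟩

open Classical in
theorem solvableInPolyTime_of_prime {F : Set (Σ m : ℕ, SimpleGraph (Fin m))} {k K : ℕ}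
    (H : SimpleGraph (Fin k)) (e : Finset (Fin k) ≃ Fin K)
    (h : SolvableInPolyTime ((setGraph H).comap e.symm)
      fun _ G => IsPrimeGraph G ∧ IsFamilyFree F G) :
    SolvableInPolyTime H fun _ G => IsFamilyFree F G := by
  obtain ⟨solve, hopt, hsolve⟩ := h.exists_solver
  let ι := {x : Σ n, SimpleGraph (Fin n) × (Fin n → Fin k → ℝ) // IsFamilyFree F x.2.1}
  let A : ι → List (List Bool) := fun x =>
    List.ofFn fun u => List.ofFn fun v => decide (x.1.2.1.Adj u v)
  let R : ι → List (List ℝ) := fun x => List.ofFn fun u => List.ofFn (x.1.2.2 u)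
  -- Copying the graph to `ℕ` lets representatives be plain numbers throughout the contractions.
  let Q : ι → SimpleGraph ℕ := fun x => x.1.2.1.map Fin.valEmbedding
  have hA : ∀ x : ι, ∀ u < x.1.1, ∀ v < x.1.1,
      lookup (A x) false u v = true ↔ (Q x).Adj u v := by
    intro x u hu v hv
    have := lookup_ofFn (fun u v => decide (x.1.2.1.Adj u v)) false ⟨u, hu⟩ ⟨v, hv⟩
    rw [show lookup (A x) false u v = _ from this, decide_eq_true_eq]
    exact (SimpleGraph.map_adj_apply (f := Fin.valEmbedding)).symm
  have hC : ∀ x : ι, ∀ L : List ℕ, L.Sublist (List.range x.1.1) →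
      IsPrimeGraph (subG (Q x) (minModule (A x) L)) ∧
        IsFamilyFree F (subG (Q x) (minModule (A x) L)) := by
    intro x L hL
    have hnd := hL.nodup List.nodup_range
    have hlt : ∀ u ∈ L, u < x.1.1 := fun u hu => List.mem_range.1 (hL.subset hu)
    have hsub := minModule_sublist (A x) L
    refine ⟨subG_minModule_isPrime hnd fun u hu v hv => hA x u (hlt u hu) v (hlt v hv),
      fun X hX hc => x.2 X hX (hc.trans ?_)⟩
    exact subG_isIndContained (hsub.nodup hnd) fun u hu => hlt u (hsub.subset hu)
  let out : ι → State := fun x => finalState solve (interIdx e) (membIdx e) (e ∅) k x.1.1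
    (A x) (R x) (Q x)
  have hpt : PolyTime (fun x : ι => x.1.1) (fun x => (A x, R x)) fun x =>
      (lookup (out x).2 (0, []) ((out x).1.headD 0) (e Finset.univ)).2 := by
    have hfst : PolyTime (fun x : ι => x.1.1) (fun x => (A x, R x)) A := PolyTime.self.fst
    have hn : PolyTime (fun x : ι => x.1.1) (fun x => (A x, R x)) fun x => x.1.1 :=
      (hfst.length (.of_le fun x => by simp [A])).congr fun x => by simp [A]
    have hs := PolyTime.finalState
      (C := fun _ G => IsPrimeGraph G ∧ IsFamilyFree F G) (memb := membIdx e) (k := k) hsolve (interIdx_le e)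
      (e ∅).is_lt.le hfst hn (fun _ => le_rfl) PolyTime.self.snd hA hC
    refine (PolyTime.entry hs.snd (hs.fst.headD (.nat 0)) (.of_le fun x => ?_) (.nat _)
      (.of_le_const _ fun _ => le_rfl)).snd
    refine PolyTime.headD_zero_le fun u hu => (List.mem_range.1 ?_).le
    exact (foldl_contract_sublist _ _ _ _ _ _ _ (.refl _)).subset hu
  obtain ⟨p, P, hp⟩ := hpt
  refine ⟨p, P, fun n G hG rev => ?_⟩
  let x : ι := ⟨⟨n, G, rev⟩, hG⟩
  obtain ⟨t, ht, ht'⟩ := hp x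
  obtain ⟨φ, hφ, hφ'⟩ : ∃ φ, (lookup (out x).2 (0, []) ((out x).1.headD 0)
      (e Finset.univ)).2 = colorList φ ∧ IsOptimum G H rev φ := by
    rcases Nat.eq_zero_or_pos n with rfl | hn
    -- Without vertices the lookup returns its default `(0, [])`, whose empty list encodes the empty
    -- coloring.
    · exact ⟨fun _ => none, rfl, fun u => u.elim0, fun ψ _ => by simp [revenue]⟩
    · obtain ⟨h1, h2⟩ := finalState_ok (G := G) (H := H) (e := e) (rev := rev) (solve := solve)
        (A := A x) (R := R x) (lookup_ofFn rev 0) (hA x)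
        fun L hL r => hopt _ _ _ (hC x L hL)
      exact h1.isOptimum hn h2
  refine ⟨φ, t, ?_, hφ', ht'⟩
  beta_reduce at ht
  rw [hφ, enc_colorList] at ht
  -- What remains is that the pair of tables `(A x, R x)` is encoded exactly as the instance.
  convert ht using 1
  refine congrArg₂ Data.pair (congrArg Data.ofList ?_) (congrArg Data.ofList ?_) <;>
  · simp only [A, R, List.map_ofFn]
    refine congrArg List.ofFn (funext fun u => congrArg Data.ofList ?_)
    rw [List.map_ofFn]
    rfl

end MaxPartial

theorem mainTheorem11 (F : Set (Σ m : ℕ, SimpleGraph (Fin m)))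
    (hprime : ∀ (k : ℕ) (H : SimpleGraph (Fin k)),
      MaxPartial.SolvableInPolyTime H
        (fun _ G => MaxPartial.IsPrimeGraph G ∧ MaxPartial.IsFamilyFree F G)) :
    ∀ (k : ℕ) (H : SimpleGraph (Fin k)),
      MaxPartial.SolvableInPolyTime H (fun _ G => MaxPartial.IsFamilyFree F G) := fun _ H =>
  MaxPartial.solvableInPolyTime_of_prime H (Fintype.equivFin _) (hprime _ _)
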